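/- Let $F,G:\mathbb{R}\to\mathbb{R}$ be $C^\infty$ functions with $G$ even, $F(0)=G(0)=F'(0)=G'(0)=0$, $F''(0)>0$ and $G''(0)>0$, and put $H(x,y)=F(x)+G(y)$. Consider the Hamiltonian system $x'=G'(y)$, $y'=-F'(x)$, which has a nondegenerate center at the origin. Let $\mathcal{P}$ be its period annulus, that is, the largest connected open neighbourhood of $(0,0)$ which, apart from the origin, is entirely filled with (nonconstant) periodic orbits; let $E^*=\sup_{\mathcal{P}}H\in(0,+\infty]$, so that $H(\mathcal{P})=[0,E^*)$; and for $0<E<E^*$ let $T(E)$ be the minimal period of the unique periodic orbit of energy $H=E$ contained in $\mathcal{P}$. Define \[ M(x,y)=\big[6F(x)F''(x)^2-3F'(x)^2F''(x)-2F(x)F'(x)F'''(x)\big]\,G(y)\,G'(y)^2+F(x)F'(x)^2F''(x)\big[G'(y)^2-2G(y)G''(y)\big] \] and, for $0<E\le+\infty$, $\Omega(E)=\{(x,y)\in\mathbb{R}^2: 0\le H(x,y)\le E\}$. Let $0<E_0\le E^*$ (where $E_0=+\infty$ is allowed if $E^*=+\infty$). If $M(x,y)\ge 0$ for all $(x,y)\in\Omega(E_0)$,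 then $T$ is monotonically increasing on $(0,E_0)$, in the sense that $T$ is differentiable with $T'(E)\ge 0$ for all $E\in(0,E_0)$. If $M(x,y)\le 0$ for all $(x,y)\in\Omega(E_0)$, then $T$ is monotonically decreasing on $(0,E_0)$, in the sense that $T$ is differentiable with $T'(E)\le 0$ for all $E\in(0,E_0)$. -/

import Mathlib

open scoped ContDiff

noncomputable section

namespace SeparableHamiltonian

/-- The Hamiltonian `H(x, y) = F(x) + G(y)`. -/
def energy (F G : ℝ → ℝ) (p : ℝ × ℝ) : ℝ := F p.1 + G p.2

/-- `γ` is a solution, defined for all times, of `x' = G'(y)`, `y' = -F'(x)`. -/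
def IsSolution (F G : ℝ → ℝ) (γ : ℝ → ℝ × ℝ) : Prop :=
  ∀ t : ℝ, HasDerivAt γ (deriv G (γ t).2, -deriv F (γ t).1) t

/-- `O` is a periodic orbit: the image of a nonconstant periodic solution. -/
def IsPeriodicOrbit (F G : ℝ → ℝ) (O : Set (ℝ × ℝ)) : Prop :=
  ∃ (γ : ℝ → ℝ × ℝ) (τ : ℝ), IsSolution F G γ ∧ 0 < τ ∧ Function.Periodic γ τ ∧
    (∃ t, γ t ≠ γ 0) ∧ Set.range γ = O

/-- `U` is a connected open neighbourhood of the origin which, apart from the origin itself,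
is entirely filled with periodic orbits. -/
def IsFilledNhd (F G : ℝ → ℝ) (U : Set (ℝ × ℝ)) : Prop :=
  IsOpen U ∧ IsConnected U ∧ (0 : ℝ × ℝ) ∈ U ∧
    ∀ p ∈ U, p ≠ 0 → ∃ O, IsPeriodicOrbit F G O ∧ p ∈ O ∧ O ⊆ U

/-- The period annulus of the center at the origin (with the origin included): the largest
neighbourhood as above.  The class of these neighbourhoods is closed under nonempty unions,
so the largest one is the union of all of them. -/
def periodAnnulus (F G : ℝ → ℝ) : Set (ℝ × ℝ) := ⋃₀ {U | IsFilledNhd F G U}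

/-- The energy `E* ∈ (0, +∞]` of the outer boundary, `H(periodAnnulus) = [0, E*)`. -/
def maxEnergy (F G : ℝ → ℝ) : EReal := ⨆ p ∈ periodAnnulus F G, (energy F G p : EReal)

/-- `τ` is the minimal period of `γ`. -/
def IsMinimalPeriod (γ : ℝ → ℝ × ℝ) (τ : ℝ) : Prop :=
  IsLeast {s : ℝ | 0 < s ∧ Function.Periodic γ s} τ

/-- The period function: `T(E)` is the minimal period of the periodic orbit of energy `E` in
the period annulus.  For `0 < E < E*` there is exactly one such orbit, so that the set below
has exactly one element. -/
def periodFunction (F G : ℝ → ℝ) (E : ℝ) : ℝ :=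
  sInf {τ : ℝ | ∃ γ : ℝ → ℝ × ℝ, IsSolution F G γ ∧ (∀ t, γ t ∈ periodAnnulus F G) ∧
    energy F G (γ 0) = E ∧ IsMinimalPeriod γ τ}

/-- The region `Ω(E) = {(x, y) : 0 ≤ H(x, y) ≤ E}`, where `E = +∞` is allowed. -/
def Omega (F G : ℝ → ℝ) (E : EReal) : Set (ℝ × ℝ) :=
  {p | 0 ≤ energy F G p ∧ (energy F G p : EReal) ≤ E}

/-- The function `M(x, y)`. -/
def M (F G : ℝ → ℝ) (x y : ℝ) : ℝ :=
  (6 * F x * (iteratedDeriv 2 F x) ^ 2 - 3 * (deriv F x) ^ 2 * iteratedDeriv 2 F x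
      - 2 * F x * deriv F x * iteratedDeriv 3 F x) * G y * (deriv G y) ^ 2
    + F x * (deriv F x) ^ 2 * iteratedDeriv 2 F x *
      ((deriv G y) ^ 2 - 2 * G y * iteratedDeriv 2 G y)

/-- `T` is monotonically increasing on `(0, E₀)`: `T'(E)` exists and is `≥ 0` there. -/
def MonotonicallyIncreasing (T : ℝ → ℝ) (E₀ : EReal) : Prop :=
  ∀ E : ℝ, 0 < E → (E : EReal) < E₀ → DifferentiableAt ℝ T E ∧ 0 ≤ deriv T E

/-- `T` is monotonically decreasing on `(0, E₀)`: `T'(E)` exists and is `≤ 0` there. -/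
def MonotonicallyDecreasing (T : ℝ → ℝ) (E₀ : EReal) : Prop :=
  ∀ E : ℝ, 0 < E → (E : EReal) < E₀ → DifferentiableAt ℝ T E ∧ deriv T E ≤ 0

end SeparableHamiltonian

end

/-! Each potential is straightened into a quadratic: smooth charts `f`, `g` satisfy F(f(u)) = u²/2
and G(g(v)) = v²/2, so the orbit of energy E = r²/2 becomes the circle u = r sin θ, v = r cos θ.
Since F'(f)f' = u and G'(g)g' = v, time along it is dt = f'(u) g'(v) dθ, and T is the integral of
this smooth density over one turn. No improper integral arises and T is differentiable in r for r >
0.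

Differentiating under the integral and integrating by parts gives r dT/dr = ∫ P dθ with P = v² f'''
g' + v g'' (f' - u f''). Expressing the derivatives of F and G through the charts yields 2 f' g' M =
F'⁴ G'² P (`two_mul_M_eq`). Hence P has the sign of M wherever F'G' ≠ 0, and by continuity on the
whole circle.

It remains to see that the charts cover the period annulus as defined by maximality. An energy is
good when F and G climb to it, with nonzero derivative, along all four half-axes. Below a good
energy the sublevel region around the origin is filled with periodic orbits (`IsGood.isFilledNhd`).
Conversely, every connected neighbourhood filled with periodic orbits contains only points of good
energy lying on the climbing branches (`IsFilledNhd.subset_good`). This is a connectedness argument: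
a limit point lies on a periodic orbit, and following that orbit through the four quadrants shows
that each half-axis climbs to its energy. -/

noncomputable section
namespace SeparableHamiltonian
open Set Filter Topology

/-! ### Monotone branches of a potential well -/

/-- `f` has positive derivative on `(0, x]`. -/
def Rises (f : ℝ → ℝ) (x : ℝ) : Prop := ∀ s, 0 < s → s ≤ x → 0 < deriv f s

/-- `f` climbs from `0` up to the value `E` through points with positive derivative. -/
def Attains (f : ℝ → ℝ) (E : ℝ) : Prop := ∃ b, 0 ≤ b ∧ f b = E ∧ Rises f b

/-- `f` is smooth with a nondegenerate local minimum of value `0` at the origin. -/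
structure IsWell (f : ℝ → ℝ) : Prop where
  smooth : ContDiff ℝ ∞ f
  zero : f 0 = 0
  deriv_zero : deriv f 0 = 0
  deriv2_pos : 0 < iteratedDeriv 2 f 0

/-- The reflection of `f`. -/
def mirror (f : ℝ → ℝ) : ℝ → ℝ := fun x => f (-x)

theorem mirror_apply (f : ℝ → ℝ) (x : ℝ) : mirror f x = f (-x) := rfl

theorem mirror_mirror (f : ℝ → ℝ) : mirror (mirror f) = f := by
  funext x; simp [mirror]

theorem deriv_mirror (f : ℝ → ℝ) (x : ℝ) : deriv (mirror f) x = -deriv f (-x) :=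
  deriv_comp_neg f x

theorem Rises.mono {f : ℝ → ℝ} {x y : ℝ} (h : Rises f y) (hxy : x ≤ y) : Rises f x :=
  fun s h0 hs => h s h0 (hs.trans hxy)

theorem rises_of_nonpos {f : ℝ → ℝ} {x : ℝ} (h : x ≤ 0) : Rises f x :=
  fun _ h0 hs => absurd (h0.trans_le hs) (not_lt.2 h)

namespace IsWell

variable {f : ℝ → ℝ}

protected theorem mirror (hf : IsWell f) : IsWell (mirror f) where
  smooth := hf.smooth.comp contDiff_neg
  zero := by simp [mirror_apply, hf.zero]
  deriv_zero := by simp [deriv_mirror, hf.deriv_zero]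
  deriv2_pos := by
    have h := hf.deriv2_pos
    have : mirror f = fun x => f (-x) := rfl
    rw [this, iteratedDeriv_comp_neg]
    simpa using h

protected theorem continuous (hf : IsWell f) : Continuous f := hf.smooth.continuous

protected theorem hasDerivAt (hf : IsWell f) (x : ℝ) : HasDerivAt f (deriv f x) x :=
  (hf.smooth.differentiable (by simp) x).hasDerivAt

theorem smooth_deriv (hf : IsWell f) : ContDiff ℝ ∞ (deriv f) :=
  (contDiff_infty_iff_deriv.1 hf.smooth).2

theorem hasDerivAt_deriv (hf : IsWell f) (x : ℝ) :
    HasDerivAt (deriv f) (iteratedDeriv 2 f x) x := by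
  have := (hf.smooth_deriv.differentiable (by simp) x).hasDerivAt
  rwa [iteratedDeriv_succ, iteratedDeriv_one]

theorem strictMonoOn_of_pos (hf : IsWell f) {x : ℝ} (h : ∀ s, 0 < s → s < x → 0 < deriv f s) :
    StrictMonoOn f (Icc 0 x) := by
  apply strictMonoOn_of_deriv_pos (convex_Icc 0 x) hf.continuous.continuousOn
  intro s hs
  rw [interior_Icc] at hs
  exact h s hs.1 hs.2

theorem strictMonoOn (hf : IsWell f) {x : ℝ} (h : Rises f x) : StrictMonoOn f (Icc 0 x) :=
  hf.strictMonoOn_of_pos fun s h0 hs => h s h0 hs.le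

theorem pos_of_rises (hf : IsWell f) {x : ℝ} (h : Rises f x) (hx : 0 < x) : 0 < f x := by
  have := hf.strictMonoOn h (left_mem_Icc.2 hx.le) (right_mem_Icc.2 hx.le) hx
  rwa [hf.zero] at this

theorem nonneg_of_rises (hf : IsWell f) {x : ℝ} (h : Rises f x) (h' : Rises (mirror f) (-x)) :
    0 ≤ f x := by
  rcases lt_trichotomy x 0 with hx | hx | hx
  · have := hf.mirror.pos_of_rises h' (by linarith)
    rw [mirror_apply, neg_neg] at this
    exact this.le
  · rw [hx, hf.zero]
  · exact (hf.pos_of_rises h hx).le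

theorem attains_zero (hf : IsWell f) : Attains f 0 :=
  ⟨0, le_rfl, hf.zero, rises_of_nonpos le_rfl⟩

theorem attains_of_rises (hf : IsWell f) {x E : ℝ} (h : Rises f x) (hx : 0 ≤ x) (hE : 0 ≤ E)
    (hEx : E ≤ f x) : Attains f E := by
  have := intermediate_value_Icc hx hf.continuous.continuousOn
  rw [hf.zero] at this
  obtain ⟨b, hb, hbE⟩ := this ⟨hE, hEx⟩
  exact ⟨b, hb.1, hbE, h.mono hb.2⟩

theorem attains_mono (hf : IsWell f) {E E' : ℝ} (h : Attains f E) (h0 : 0 ≤ E') (hE : E' ≤ E) :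
    Attains f E' := by
  obtain ⟨b, hb, rfl, hr⟩ := h
  exact hf.attains_of_rises hr hb h0 hE

theorem eventually_deriv_pos (hf : IsWell f) : ∀ᶠ s in 𝓝[>] (0 : ℝ), 0 < deriv f s := by
  have h := (hf.hasDerivAt_deriv 0).hasDerivWithinAt (s := Ioi 0)
  rw [hasDerivWithinAt_iff_tendsto_slope' (by simp)] at h
  filter_upwards [h.eventually (lt_mem_nhds hf.deriv2_pos), self_mem_nhdsWithin] with s hs h0
  rw [slope_def_field, hf.deriv_zero, sub_zero, sub_zero] at hs
  have h0 : 0 < s := h0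
  exact (div_pos_iff_of_pos_right h0).1 hs

theorem exists_rises_gt (hf : IsWell f) {b : ℝ} (hb : 0 ≤ b) (h : Rises f b) :
    ∃ c, b < c ∧ Rises f c := by
  have key : ∀ᶠ s in 𝓝[>] b, 0 < deriv f s := by
    rcases hb.eq_or_lt with rfl | hb
    · exact hf.eventually_deriv_pos
    · exact (hf.smooth_deriv.continuous.continuousAt.eventually
        (lt_mem_nhds (h b hb le_rfl))).filter_mono nhdsWithin_le_nhds
  obtain ⟨c, hc, hbc⟩ := (mem_nhdsGT_iff_exists_Ioc_subset).1 key
  refine ⟨c, hc, fun s h0 hs => ?_⟩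
  rcases le_or_gt s b with h1 | h1
  · exact h s h0 h1
  · exact hbc ⟨h1, hs⟩

theorem exists_attains_gt (hf : IsWell f) {E : ℝ} (h : Attains f E) :
    ∃ E', E < E' ∧ Attains f E' := by
  obtain ⟨b, hb, rfl, hr⟩ := h
  obtain ⟨c, hc, hrc⟩ := hf.exists_rises_gt hb hr
  refine ⟨f c, ?_, c, by linarith, rfl, hrc⟩
  exact hf.strictMonoOn hrc ⟨hb, hc.le⟩ ⟨by linarith, le_rfl⟩ hc

/-- If x lay beyond the point where the level E is attained, monotonicity would force f(x) > E. -/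
theorem rises_of_attains (hf : IsWell f) {x E : ℝ} (h : Attains f E)
    (hx : ∀ s, 0 < s → s < x → 0 < deriv f s) (hE : f x < E) : Rises f x := by
  obtain ⟨b, hb, rfl, hr⟩ := h
  rcases le_or_gt x b with hxb | hxb
  · exact hr.mono hxb
  · have := hf.strictMonoOn_of_pos hx ⟨hb, hxb.le⟩ ⟨by linarith, le_rfl⟩ hxb
    linarith

end IsWell

/-! ### Smooth charts turning a well into a quadratic -/

theorem hasDerivAt_integral_of_continuous {K K' : ℝ → ℝ → ℝ}
    (hK : Continuous (Function.uncurry K)) (hK' : Continuous (Function.uncurry K'))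
    (h : ∀ x t, HasDerivAt (fun x => K x t) (K' x t) x) (a b x₀ : ℝ) :
    HasDerivAt (fun x => ∫ t in a..b, K x t) (∫ t in a..b, K' x₀ t) x₀ := by
  obtain ⟨C, hC⟩ := ((isCompact_closedBall x₀ 1).prod (isCompact_uIcc (a := a) (b := b))
    ).exists_bound_of_continuousOn (f := Function.uncurry K') hK'.continuousOn
  have hc : ∀ x, Continuous (K x) := fun x => hK.comp (by fun_prop : Continuous fun t => (x, t))
  have hc' : ∀ x, Continuous (K' x) := fun x => hK'.comp (by fun_prop : Continuous fun t => (x, t))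
  refine (intervalIntegral.hasDerivAt_integral_of_dominated_loc_of_deriv_le
    (F := K) (F' := K') (bound := fun _ => C) (s := Metric.closedBall x₀ 1)
    (Metric.closedBall_mem_nhds x₀ one_pos) ?_ ?_ ?_ ?_ ?_ ?_).2
  · exact Eventually.of_forall fun x => (hc x).aestronglyMeasurable
  · exact (hc x₀).intervalIntegrable _ _
  · exact (hc' x₀).aestronglyMeasurable
  · refine Eventually.of_forall fun t ht x hx => ?_
    exact hC (x, t) ⟨hx, uIoc_subset_uIcc ht⟩
  · exact intervalIntegrable_const
  · exact Eventually.of_forall fun t _ x _ => h x t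

/-- The weight w is kept general because differentiation in x turns (w, φ) into (t w(t), φ'), an
integral of the same shape, so the induction closes. -/
theorem contDiff_integral_mul_comp_mul (n : ℕ) : ∀ {w φ : ℝ → ℝ}, Continuous w →
    ContDiff ℝ ∞ φ → ContDiff ℝ n fun x => ∫ t in (0 : ℝ)..1, w t * φ (t * x) := by
  have hd : ∀ {w φ : ℝ → ℝ}, Continuous w → ContDiff ℝ ∞ φ → ∀ x : ℝ,
      HasDerivAt (fun x => ∫ t in (0 : ℝ)..1, w t * φ (t * x))
        (∫ t in (0 : ℝ)..1, (w t * t) * deriv φ (t * x)) x := by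
    intro w φ hw hφ x
    have h1 : Continuous φ := hφ.continuous
    have h2 : Continuous (deriv φ) := hφ.continuous_deriv (by simp)
    refine hasDerivAt_integral_of_continuous (K := fun x t => w t * φ (t * x))
      (K' := fun x t => (w t * t) * deriv φ (t * x)) (by fun_prop) (by fun_prop) ?_ 0 1 x
    intro x t
    have h3 : HasDerivAt (fun x => t * x) t x := by simpa using (hasDerivAt_id x).const_mul t
    have h4 := ((hφ.differentiable (by simp) (t * x)).hasDerivAt.comp x h3).const_mul (w t)
    exact h4.congr_deriv (by ring)
  induction n with
  | zero =>
    intro w φ hw hφ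
    exact contDiff_zero.2 (continuous_iff_continuousAt.2 fun x => (hd hw hφ x).continuousAt)
  | succ n ih =>
    intro w φ hw hφ
    push_cast
    rw [contDiff_succ_iff_deriv]
    refine ⟨fun x => (hd hw hφ x).differentiableAt, by simp, ?_⟩
    rw [show deriv (fun x => ∫ t in (0 : ℝ)..1, w t * φ (t * x)) = _ from
      funext fun x => (hd hw hφ x).deriv]
    exact ih (by fun_prop) (contDiff_infty_iff_deriv.1 hφ).2

/-- Taylor's formula with integral remainder: h(x) = ∫₀¹ (1 - t) f''(tx) dt, with h(0) = f''(0)/2.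
-/
theorem IsWell.exists_eq_sq_mul {f : ℝ → ℝ} (hf : IsWell f) :
    ∃ h : ℝ → ℝ, ContDiff ℝ ∞ h ∧ 0 < h 0 ∧ ∀ x, f x = x ^ 2 * h x := by
  have h2 : ContDiff ℝ ∞ (iteratedDeriv 2 f) := by
    rw [iteratedDeriv_succ, iteratedDeriv_one]
    exact (contDiff_infty_iff_deriv.1 hf.smooth_deriv).2
  refine ⟨fun x => ∫ t in (0 : ℝ)..1, (1 - t) * iteratedDeriv 2 f (t * x), ?_, ?_, ?_⟩
  · exact contDiff_infty.2 fun n => contDiff_integral_mul_comp_mul n (by fun_prop) h2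
  · have : (∫ t in (0 : ℝ)..1, (1 - t)) = 1 / 2 := by
      rw [intervalIntegral.integral_sub (by simp) (by simp)]; norm_num
    simp only [mul_zero, intervalIntegral.integral_mul_const, this]
    have := hf.deriv2_pos
    positivity
  · intro x
    have hc : Continuous fun t : ℝ => x ^ 2 * ((1 - t) * iteratedDeriv 2 f (t * x)) := by
      have := h2.continuous
      fun_prop
    have key : ∀ t : ℝ, HasDerivAt (fun t => (1 - t) * (deriv f (t * x) * x) + f (t * x))
        (x ^ 2 * ((1 - t) * iteratedDeriv 2 f (t * x))) t := by
      intro t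
      have h3 : HasDerivAt (fun t => t * x) x t := by simpa using (hasDerivAt_id t).mul_const x
      have h4 := ((hf.hasDerivAt_deriv (t * x)).comp t h3).mul_const x
      have h5 := (hf.hasDerivAt (t * x)).comp t h3
      have h6 := ((hasDerivAt_id t).const_sub 1).mul h4
      refine (h6.add h5).congr_deriv ?_
      simp only [id, Function.comp]
      ring
    rw [← intervalIntegral.integral_const_mul,
      intervalIntegral.integral_eq_sub_of_hasDerivAt (fun t _ => key t)
        (hc.intervalIntegrable _ _)]
    simp [hf.zero, hf.deriv_zero]

/-- `f` is a coordinate change turning `F` into `u ↦ u ^ 2 / 2` on `(-ρ, ρ)`. -/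
structure IsChart (F : ℝ → ℝ) (ρ : ℝ) (f : ℝ → ℝ) : Prop where
  smooth : ContDiff ℝ ∞ f
  deriv_pos : ∀ u, |u| < ρ → 0 < deriv f u
  eq_sq : ∀ u, |u| < ρ → F (f u) = u ^ 2 / 2
  rises : ∀ u, |u| < ρ → Rises F (f u)
  rises_mirror : ∀ u, |u| < ρ → Rises (mirror F) (-f u)
  surj : ∀ x, Rises F x → Rises (mirror F) (-x) → F x < ρ ^ 2 / 2 → ∃ u, |u| < ρ ∧ f u = x

/-- Continuity of g is not assumed. The local inverse given by the inverse function theorem also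
takes values in s near u, and injectivity of w on s makes it agree with g. -/
theorem contDiffAt_of_right_inverse {w g : ℝ → ℝ} {s : Set ℝ} {u : ℝ} (hs : s ∈ 𝓝 (g u))
    (hinj : InjOn w s) (hg : ∀ᶠ v in 𝓝 u, g v ∈ s ∧ w (g v) = v)
    (hw : ContDiffAt ℝ ∞ w (g u)) (hd : deriv w (g u) ≠ 0) : ContDiffAt ℝ ∞ g u := by
  have hu : w (g u) = u := hg.self_of_nhds.2
  have h1 : HasDerivAt w (deriv w (g u)) (g u) := (hw.differentiableAt (by simp)).hasDerivAt
  let e : ℝ ≃L[ℝ] ℝ := ContinuousLinearEquiv.unitsEquivAut ℝ (Units.mk0 _ hd)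
  have h2 : HasFDerivAt w (e : ℝ →L[ℝ] ℝ) (g u) := by
    refine h1.hasFDerivAt.congr_fderiv ?_
    ext
    simp [e]
  have h3 := hw.to_localInverse h2 (by simp)
  have h4 : ContinuousAt (hw.localInverse h2 (by simp)) (w (g u)) := h3.continuousAt
  have h5 : ∀ᶠ v in 𝓝 (w (g u)), w (hw.localInverse h2 (by simp) v) = v :=
    (hw.hasStrictFDerivAt' h2 (by simp)).eventually_right_inverse
  have h6 := h4.eventually (show s ∈ 𝓝 (hw.localInverse h2 (by simp) (w (g u))) by
    rwa [hw.localInverse_apply_image h2 (by simp)])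
  rw [hu] at h3 h5 h6
  refine h3.congr_of_eventuallyEq ?_
  filter_upwards [hg, h5, h6] with v h7 h8 h9
  exact hinj h7.1 h9 (h7.2.trans h8.symm)

/-- Writing F = x² h, the function w = x √(2h) is a smooth signed square root of 2F, strictly
increasing on the climbing interval; the chart is its inverse, cut off to be smooth on the whole
line. -/
theorem IsWell.exists_chart {F : ℝ → ℝ} (hF : IsWell F) {ρ : ℝ} (hρ : 0 < ρ)
    (hr : Attains F (ρ ^ 2 / 2)) (hl : Attains (mirror F) (ρ ^ 2 / 2)) : ∃ f, IsChart F ρ f := by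
  obtain ⟨Er, hEr, har⟩ := hF.exists_attains_gt hr
  obtain ⟨El, hEl, hal⟩ := hF.mirror.exists_attains_gt hl
  have hρ2 : 0 < ρ ^ 2 / 2 := by positivity
  -- A common level strictly above ρ²/2 leaves room beyond |u| = ρ for the cutoff.
  obtain ⟨E, hE, har, hal⟩ : ∃ E, ρ ^ 2 / 2 < E ∧ Attains F E ∧ Attains (mirror F) E := by
    have h : ρ ^ 2 / 2 < min Er El := lt_min hEr hEl
    exact ⟨_, h, hF.attains_mono har (hρ2.trans h).le (min_le_left _ _),
      hF.mirror.attains_mono hal (hρ2.trans h).le (min_le_right _ _)⟩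
  obtain ⟨b, hb, hbE, hrb⟩ := har
  obtain ⟨a, ha, haE, hra⟩ := hal
  obtain ⟨h, hh, hh0, hFh⟩ := hF.exists_eq_sq_mul
  have hE0 : 0 < E := hρ2.trans hE
  have hmF : ∀ x, mirror F x = F (-x) := fun _ => rfl
  have hb : 0 < b := by
    rcases hb.eq_or_lt with rfl | hb
    · rw [hF.zero] at hbE; linarith
    · exact hb
  have ha : 0 < a := by
    rcases ha.eq_or_lt with rfl | ha
    · rw [hF.mirror.zero] at haE; linarith
    · exact ha
  have hFpos : ∀ x ∈ Icc (-a) b, x ≠ 0 → 0 < F x := by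
    intro x hx hx0
    rcases lt_or_gt_of_ne hx0 with h0 | h0
    · have := hF.mirror.pos_of_rises (hra.mono (neg_le.1 hx.1)) (neg_pos.2 h0)
      rwa [hmF, neg_neg] at this
    · exact hF.pos_of_rises (hrb.mono hx.2) h0
  have hhpos : ∀ x ∈ Icc (-a) b, 0 < h x := by
    intro x hx
    rcases eq_or_ne x 0 with rfl | hx0
    · exact hh0
    · have := hFpos x hx hx0
      rw [hFh] at this
      exact (mul_pos_iff_of_pos_left (by positivity)).1 this
  set w : ℝ → ℝ := fun x => x * √(2 * h x) with hw
  have hwsq : ∀ x ∈ Icc (-a) b, w x ^ 2 = 2 * F x := by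
    intro x hx
    have := hhpos x hx
    rw [hw, hFh]
    simp only
    rw [mul_pow, Real.sq_sqrt (by positivity)]
    ring
  have hwsm : ∀ x ∈ Icc (-a) b, ContDiffAt ℝ ∞ w x := by
    intro x hx
    have := hhpos x hx
    exact contDiffAt_id.mul ((contDiffAt_const.mul hh.contDiffAt).sqrt (by positivity))
  have hwd : ∀ x ∈ Icc (-a) b, HasDerivAt w (deriv w x) x := fun x hx =>
    ((hwsm x hx).differentiableAt (by simp)).hasDerivAt
  have hwd' : ∀ x ∈ Ioo (-a) b, 0 < deriv w x := by
    intro x hx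
    have hx' := Ioo_subset_Icc_self hx
    have hs : 0 < √(2 * h x) := Real.sqrt_pos.2 (by have := hhpos x hx'; positivity)
    have h1 : w x * deriv w x = deriv F x := by
      have h2 := (hwd x hx').pow 2
      have h3 : HasDerivAt (fun x => w x ^ 2) (2 * deriv F x) x := by
        refine ((hF.hasDerivAt x).const_mul 2).congr_of_eventuallyEq ?_
        filter_upwards [Ioo_mem_nhds hx.1 hx.2] with y hy
        exact hwsq y (Ioo_subset_Icc_self hy)
      have := h2.unique h3
      simp at this
      linarith
    rcases lt_trichotomy x 0 with h0 | h0 | h0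
    · have h2 := hra (-x) (by linarith) (by linarith [hx.1])
      rw [deriv_mirror, neg_neg] at h2
      have h3 : w x < 0 := mul_neg_of_neg_of_pos h0 hs
      rw [← h1] at h2
      by_contra h4
      nlinarith [not_lt.1 h4]
    -- At the origin w w' = F' reads 0 = 0, so w'(0) = √(2h(0)) comes from the product rule instead.
    · subst h0
      have h2 : HasDerivAt w (1 * √(2 * h 0) + 0 * deriv (fun x => √(2 * h x)) 0) 0 := by
        refine (hasDerivAt_id 0).mul (DifferentiableAt.hasDerivAt ?_)
        exact ((contDiffAt_const.mul hh.contDiffAt).sqrt (by positivity)).differentiableAt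
          (n := ∞) (by simp)
      rw [h2.deriv]
      simpa using hs
    · have h2 := hrb x h0 hx.2.le
      have h3 : 0 < w x := mul_pos h0 hs
      rw [← h1] at h2
      exact (mul_pos_iff_of_pos_left h3).1 h2
  have hwc : ContinuousOn w (Icc (-a) b) := fun x hx => (hwsm x hx).continuousAt.continuousWithinAt
  have hmono : StrictMonoOn w (Icc (-a) b) := by
    refine strictMonoOn_of_deriv_pos (convex_Icc _ _) hwc ?_
    rw [interior_Icc]
    exact hwd'
  set ρ₁ : ℝ := √(2 * E) with hρ₁
  have hρρ : ρ < ρ₁ := Real.lt_sqrt_of_sq_lt (by linarith)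
  have hbI : b ∈ Icc (-a) b := ⟨by linarith, le_rfl⟩
  have haI : -a ∈ Icc (-a) b := ⟨le_rfl, by linarith⟩
  have hwb : w b = ρ₁ := by
    have h1 : 0 ≤ w b := by positivity
    rw [hρ₁, ← hbE, ← hwsq b hbI, Real.sqrt_sq h1]
  have hwa : w (-a) = -ρ₁ := by
    have h1 : 0 ≤ -w (-a) := by simp only [hw]; rw [neg_mul, neg_neg]; positivity
    rw [hρ₁, ← haE, hmF, ← hwsq _ haI, ← neg_sq, Real.sqrt_sq h1, neg_neg]
  have hex : ∀ u, |u| < ρ₁ → ∃ x, x ∈ Ioo (-a) b ∧ w x = u := by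
    intro u hu
    have h1 := intermediate_value_Ioo (by linarith : -a ≤ b) hwc
    rw [hwa, hwb] at h1
    obtain ⟨x, hx, hxu⟩ := h1 (abs_lt.1 hu)
    exact ⟨x, hx, hxu⟩
  choose! g hgI hwg using hex
  have hball : ∀ u, |u| < ρ₁ → ∀ᶠ v in 𝓝 u, |v| < ρ₁ := fun u hu =>
    continuous_abs.continuousAt.eventually (gt_mem_nhds hu)
  have hgsm : ∀ u, |u| < ρ₁ → ContDiffAt ℝ ∞ g u := by
    intro u hu
    refine contDiffAt_of_right_inverse (Ioo_mem_nhds (hgI u hu).1 (hgI u hu).2)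
      (hmono.injOn.mono Ioo_subset_Icc_self) ?_ (hwsm _ (Ioo_subset_Icc_self (hgI u hu)))
      (hwd' _ (hgI u hu)).ne'
    filter_upwards [hball u hu] with v hv
    exact ⟨hgI v hv, hwg v hv⟩
  -- The bump is 1 for |u| ≤ ρ and supported strictly inside |u| < ρ₁, where the inverse g is
  -- smooth; thus χ g is smooth everywhere.
  let χ : ContDiffBump (0 : ℝ) := ⟨ρ, (ρ + ρ₁) / 2, hρ, by linarith⟩
  have hχ1 : ∀ u, |u| < ρ → χ u = 1 := by
    intro u hu
    apply χ.one_of_mem_closedBall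
    rw [mem_closedBall_zero_iff, Real.norm_eq_abs]
    exact hu.le
  have hfg : ∀ u, |u| < ρ → (fun u => χ u * g u) =ᶠ[𝓝 u] g := by
    intro u hu
    filter_upwards [continuous_abs.continuousAt.eventually (gt_mem_nhds hu)] with v hv
    rw [hχ1 v hv, one_mul]
  have hlt : ∀ u, |u| < ρ → |u| < ρ₁ := fun u hu => hu.trans hρρ
  refine ⟨fun u => χ u * g u, ?_, ?_, ?_, ?_, ?_, ?_⟩
  · rw [contDiff_iff_contDiffAt]
    intro u
    rcases lt_or_ge |u| ρ₁ with hu | hu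
    · exact χ.contDiff.contDiffAt.mul (hgsm u hu)
    · have h1 : u ∉ tsupport χ := by
        rw [χ.tsupport_eq, mem_closedBall_zero_iff, Real.norm_eq_abs, not_le]
        change (ρ + ρ₁) / 2 < |u|
        linarith
      refine (contDiffAt_const (c := (0 : ℝ))).congr_of_eventuallyEq ?_
      filter_upwards [notMem_tsupport_iff_eventuallyEq.1 h1] with v hv
      simp [hv]
  · intro u hu
    rw [(hfg u hu).deriv_eq]
    have h1 := ((hgsm u (hlt u hu)).differentiableAt (by simp)).hasDerivAt
    have h2 := (hwd (g u) (Ioo_subset_Icc_self (hgI u (hlt u hu)))).comp u h1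
    have h3 : HasDerivAt (w ∘ g) 1 u := by
      refine (hasDerivAt_id u).congr_of_eventuallyEq ?_
      filter_upwards [hball u (hlt u hu)] with v hv
      exact hwg v hv
    have h4 := h2.unique h3
    have h5 := hwd' _ (hgI u (hlt u hu))
    by_contra h6
    nlinarith [not_lt.1 h6]
  · intro u hu
    have := hwsq _ (Ioo_subset_Icc_self (hgI u (hlt u hu)))
    rw [hwg u (hlt u hu)] at this
    simp only [hχ1 u hu, one_mul]
    linarith
  · intro u hu
    simp only [hχ1 u hu, one_mul]
    exact hrb.mono (hgI u (hlt u hu)).2.le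
  · intro u hu
    simp only [hχ1 u hu, one_mul]
    exact hra.mono (neg_le.1 (hgI u (hlt u hu)).1.le)
  · intro x hx hx' hFx
    have hxI : x ∈ Icc (-a) b := by
      constructor
      · by_contra h1
        have := hF.mirror.strictMonoOn hx' ⟨ha.le, by linarith⟩ ⟨by linarith, le_rfl⟩
          (by linarith : a < -x)
        rw [haE, hmF, neg_neg] at this
        linarith
      · by_contra h1
        have := hF.strictMonoOn hx ⟨hb.le, by linarith⟩ ⟨by linarith, le_rfl⟩
          (by linarith : b < x)
        linarith
    have hu : |w x| < ρ := by
      rw [← abs_of_pos hρ, ← sq_lt_sq, hwsq x hxI]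
      linarith
    refine ⟨w x, hu, ?_⟩
    simp only [hχ1 _ hu, one_mul]
    exact hmono.injOn (Ioo_subset_Icc_self (hgI _ (hlt _ hu))) hxI (hwg _ (hlt _ hu))

/-! ### The period as an integral over a circle, and its derivative -/

/-- The speed of time along the circle of radius `r` in the coordinates given by `f` and `g`. -/
def timeDensity (f g : ℝ → ℝ) (r θ : ℝ) : ℝ := deriv f (r * Real.sin θ) * deriv g (r * Real.cos θ)

/-- The time of one revolution on the circle of radius `r`. -/
def periodIntegral (f g : ℝ → ℝ) (r : ℝ) : ℝ := ∫ θ in (0 : ℝ)..2 * Real.pi, timeDensity f g r θ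

/-- The integrand of `r T'(r)` after an integration by parts. -/
def periodDerivDensity (f g : ℝ → ℝ) (u v : ℝ) : ℝ :=
  v ^ 2 * deriv (deriv (deriv f)) u * deriv g v +
    v * deriv (deriv g) v * (deriv f u - u * deriv (deriv f) u)

theorem hasDerivAt_of_smooth {f : ℝ → ℝ} (hf : ContDiff ℝ ∞ f) (x : ℝ) :
    HasDerivAt f (deriv f x) x := (hf.differentiable (by simp) x).hasDerivAt

theorem hasDerivAt_periodIntegral {f g : ℝ → ℝ} (hf : ContDiff ℝ ∞ f) (hg : ContDiff ℝ ∞ g)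
    {r : ℝ} (hr : r ≠ 0) :
    HasDerivAt (periodIntegral f g) (r⁻¹ * ∫ θ in (0 : ℝ)..2 * Real.pi,
      periodDerivDensity f g (r * Real.sin θ) (r * Real.cos θ)) r := by
  have hf1 := (contDiff_infty_iff_deriv.1 hf).2
  have hf2 := (contDiff_infty_iff_deriv.1 hf1).2
  have hf3 := (contDiff_infty_iff_deriv.1 hf2).2
  have hg1 := (contDiff_infty_iff_deriv.1 hg).2
  have hg2 := (contDiff_infty_iff_deriv.1 hg1).2
  have cf1 := hf1.continuous
  have cf2 := hf2.continuous
  have cf3 := hf3.continuous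
  have cg1 := hg1.continuous
  have cg2 := hg2.continuous
  let D : ℝ → ℝ → ℝ := fun r θ =>
    deriv (deriv f) (r * Real.sin θ) * Real.sin θ * deriv g (r * Real.cos θ) +
      deriv f (r * Real.sin θ) * (deriv (deriv g) (r * Real.cos θ) * Real.cos θ)
  have h1 : HasDerivAt (periodIntegral f g) (∫ θ in (0 : ℝ)..2 * Real.pi, D r θ) r := by
    refine hasDerivAt_integral_of_continuous (K := timeDensity f g) (K' := D) ?_ ?_ ?_ _ _ r
    · unfold timeDensity Function.uncurry
      fun_prop
    · simp only [D]
      unfold Function.uncurry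
      fun_prop
    · intro r θ
      have e1 : HasDerivAt (fun r => r * Real.sin θ) (Real.sin θ) r := by
        simpa using (hasDerivAt_id r).mul_const (Real.sin θ)
      have e2 : HasDerivAt (fun r => r * Real.cos θ) (Real.cos θ) r := by
        simpa using (hasDerivAt_id r).mul_const (Real.cos θ)
      exact ((hasDerivAt_of_smooth hf1 _).comp r e1).mul ((hasDerivAt_of_smooth hg1 _).comp r e2)
  refine h1.congr_deriv ?_
  -- Boundary term of the integration by parts: Q is 2π-periodic, and subtracting Q' from the
  -- differentiated integrand trades sin θ f'' g' for terms containing f''' and f'' g''.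
  let Q : ℝ → ℝ := fun θ =>
    -Real.cos θ * (deriv (deriv f) (r * Real.sin θ) * deriv g (r * Real.cos θ))
  let Q' : ℝ → ℝ := fun θ =>
    D r θ - r⁻¹ * periodDerivDensity f g (r * Real.sin θ) (r * Real.cos θ)
  have cB : Continuous fun θ => r⁻¹ * periodDerivDensity f g (r * Real.sin θ) (r * Real.cos θ) := by
    unfold periodDerivDensity
    fun_prop
  have cD : Continuous (D r) := by
    simp only [D]
    fun_prop
  have hQ : ∀ θ, HasDerivAt Q (Q' θ) θ := by
    intro θ
    have e1 : HasDerivAt (fun θ => r * Real.sin θ) (r * Real.cos θ) θ :=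
      (Real.hasDerivAt_sin θ).const_mul r
    have e2 : HasDerivAt (fun θ => r * Real.cos θ) (r * -Real.sin θ) θ :=
      (Real.hasDerivAt_cos θ).const_mul r
    have e3 := (Real.hasDerivAt_cos θ).neg.mul
      (((hasDerivAt_of_smooth hf2 _).comp θ e1).mul ((hasDerivAt_of_smooth hg1 _).comp θ e2))
    refine e3.congr_deriv ?_
    simp only [Q', D, periodDerivDensity, Function.comp, Pi.mul_apply, Pi.neg_apply]
    field_simp
    ring
  have h2 : ∫ θ in (0 : ℝ)..2 * Real.pi, Q' θ = 0 := by
    rw [intervalIntegral.integral_eq_sub_of_hasDerivAt (fun θ _ => hQ θ)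
      ((cD.sub cB).intervalIntegrable _ _)]
    simp [Q]
  rw [intervalIntegral.integral_sub (cD.intervalIntegrable _ _) (cB.intervalIntegrable _ _),
    intervalIntegral.integral_const_mul] at h2
  linarith

theorem continuous_periodDerivDensity {f g : ℝ → ℝ} (hf : ContDiff ℝ ∞ f) (hg : ContDiff ℝ ∞ g) :
    Continuous fun p : ℝ × ℝ => periodDerivDensity f g p.1 p.2 := by
  have hf1 := (contDiff_infty_iff_deriv.1 hf).2
  have hf2 := (contDiff_infty_iff_deriv.1 hf1).2
  have hf3 := (contDiff_infty_iff_deriv.1 hf2).2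
  have hg1 := (contDiff_infty_iff_deriv.1 hg).2
  have hg2 := (contDiff_infty_iff_deriv.1 hg1).2
  have cf1 := hf1.continuous
  have cf2 := hf2.continuous
  have cf3 := hf3.continuous
  have cg1 := hg1.continuous
  have cg2 := hg2.continuous
  unfold periodDerivDensity
  fun_prop

/-! ### Chart derivatives and the sign of `M` -/

namespace IsChart

variable {F f : ℝ → ℝ} {ρ : ℝ}

theorem eventually_abs_lt {u : ℝ} (hu : |u| < ρ) : ∀ᶠ v in 𝓝 u, |v| < ρ :=
  continuous_abs.continuousAt.eventually (gt_mem_nhds hu)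

theorem deriv_mul (h : IsChart F ρ f) (hF : IsWell F) {u : ℝ} (hu : |u| < ρ) :
    deriv F (f u) * deriv f u = u := by
  have h1 := (hF.hasDerivAt (f u)).comp u (hasDerivAt_of_smooth h.smooth u)
  have h2 : HasDerivAt (F ∘ f) u u := by
    have h3 : HasDerivAt (fun u : ℝ => u ^ 2 / 2) u u := by
      refine ((hasDerivAt_pow 2 u).div_const 2).congr_deriv ?_
      simp
    exact h3.congr_of_eventuallyEq ((eventually_abs_lt hu).mono fun v hv => h.eq_sq v hv)
  exact h1.unique h2

theorem deriv2_mul (h : IsChart F ρ f) (hF : IsWell F) {u : ℝ} (hu : |u| < ρ) :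
    iteratedDeriv 2 F (f u) * deriv f u ^ 2 + deriv F (f u) * deriv (deriv f) u = 1 := by
  have hf1 := (contDiff_infty_iff_deriv.1 h.smooth).2
  have h1 := ((hF.hasDerivAt_deriv (f u)).comp u (hasDerivAt_of_smooth h.smooth u)).mul
    (hasDerivAt_of_smooth hf1 u)
  have h2 : HasDerivAt ((deriv F ∘ f) * deriv f) 1 u :=
    (hasDerivAt_id u).congr_of_eventuallyEq
      ((eventually_abs_lt hu).mono fun v hv => h.deriv_mul hF hv)
  have := h1.unique h2
  simp only [Function.comp] at this
  linarith

theorem deriv3_mul (h : IsChart F ρ f) (hF : IsWell F) {u : ℝ} (hu : |u| < ρ) :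
    iteratedDeriv 3 F (f u) * deriv f u ^ 3 + 3 * iteratedDeriv 2 F (f u) * deriv f u *
      deriv (deriv f) u + deriv F (f u) * deriv (deriv (deriv f)) u = 0 := by
  have hf1 := (contDiff_infty_iff_deriv.1 h.smooth).2
  have hf2 := (contDiff_infty_iff_deriv.1 hf1).2
  have hF2 : ContDiff ℝ ∞ (iteratedDeriv 2 F) := by
    rw [iteratedDeriv_succ, iteratedDeriv_one]
    exact (contDiff_infty_iff_deriv.1 hF.smooth_deriv).2
  have hF3 : ∀ x, HasDerivAt (iteratedDeriv 2 F) (iteratedDeriv 3 F x) x := by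
    intro x
    rw [iteratedDeriv_succ (n := 2)]
    exact hasDerivAt_of_smooth hF2 x
  have h0 := hasDerivAt_of_smooth h.smooth u
  have h1 := (((hF3 (f u)).comp u h0).mul ((hasDerivAt_of_smooth hf1 u).pow 2)).add
    (((hF.hasDerivAt_deriv (f u)).comp u h0).mul (hasDerivAt_of_smooth hf2 u))
  have h2 : HasDerivAt ((iteratedDeriv 2 F ∘ f) * deriv f ^ 2 + (deriv F ∘ f) * deriv (deriv f))
      0 u :=
    (hasDerivAt_const u (1 : ℝ)).congr_of_eventuallyEq
      ((eventually_abs_lt hu).mono fun v hv => h.deriv2_mul hF hv)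
  have := h1.unique h2
  simp at this
  linarith

end IsChart

/-- The first three derivatives of F(f(u)) = u²/2 and the first two of G(g(v)) = v²/2 determine u,
v, F'', F''', G'' from F', G' and the chart derivatives. Only f' and g' are divided by, so the
identity also holds on the axes. -/
theorem two_mul_M_eq {F G f g : ℝ → ℝ} {ρ : ℝ} (hF : IsWell F) (hG : IsWell G)
    (hf : IsChart F ρ f) (hg : IsChart G ρ g) {u v : ℝ} (hu : |u| < ρ) (hv : |v| < ρ) :
    2 * (deriv f u * deriv g v) * M F G (f u) (g v) =
      deriv F (f u) ^ 4 * deriv G (g v) ^ 2 * periodDerivDensity f g u v := by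
  have a1 := hf.deriv_mul hF hu
  have a2 := hf.deriv2_mul hF hu
  have a3 := hf.deriv3_mul hF hu
  have b1 := hg.deriv_mul hG hv
  have b2 := hg.deriv2_mul hG hv
  have p1 := hf.deriv_pos u hu
  have p2 := hg.deriv_pos v hv
  unfold M periodDerivDensity
  rw [hf.eq_sq u hu, hg.eq_sq v hv]
  generalize deriv F (f u) = F1 at *
  generalize iteratedDeriv 2 F (f u) = F2 at *
  generalize iteratedDeriv 3 F (f u) = F3 at *
  generalize deriv G (g v) = G1 at *
  generalize iteratedDeriv 2 G (g v) = G2 at *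
  generalize deriv (deriv (deriv f)) u = f3 at *
  generalize deriv (deriv f) u = f2 at *
  generalize deriv f u = f1 at *
  generalize deriv (deriv g) v = g2 at *
  generalize deriv g v = g1 at *
  have e2 : F2 = (1 - F1 * f2) / f1 ^ 2 := by field_simp; linarith
  have e3 : F3 = -(3 * F2 * f1 * f2 + F1 * f3) / f1 ^ 3 := by field_simp; linarith
  have d2 : G2 = (1 - G1 * g2) / g1 ^ 2 := by field_simp; linarith
  subst e3 e2 d2 a1 b1
  field_simp
  ring

theorem dense_sin_mul_cos_ne_zero : Dense {θ : ℝ | Real.sin θ * Real.cos θ ≠ 0} := by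
  have : {θ : ℝ | Real.sin θ * Real.cos θ ≠ 0} = (range fun n : ℤ => n * Real.pi / 2)ᶜ := by
    ext θ
    simp only [mem_ofPred_eq, mem_compl_iff, mem_range, not_iff_not]
    have : Real.sin θ * Real.cos θ = 0 ↔ Real.sin (2 * θ) = 0 := by
      rw [Real.sin_two_mul, mul_assoc]; simp
    rw [this, Real.sin_eq_zero_iff]
    refine exists_congr fun n => ⟨fun h => by linarith, fun h => by linarith⟩
  rw [this]
  exact (countable_range _).dense_compl ℝ

theorem abs_mul_sin_lt {r ρ : ℝ} (hr : 0 < r) (hrρ : r < ρ) (θ : ℝ) : |r * Real.sin θ| < ρ := by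
  rw [abs_mul, abs_of_pos hr]
  nlinarith [Real.abs_sin_le_one θ]

theorem abs_mul_cos_lt {r ρ : ℝ} (hr : 0 < r) (hrρ : r < ρ) (θ : ℝ) : |r * Real.cos θ| < ρ := by
  rw [abs_mul, abs_of_pos hr]
  nlinarith [Real.abs_cos_le_one θ]

theorem periodDerivDensity_sign {F G f g : ℝ → ℝ} {ρ r : ℝ} (hF : IsWell F) (hG : IsWell G)
    (hf : IsChart F ρ f) (hg : IsChart G ρ g) (hr : 0 < r) (hrρ : r < ρ) {σ : ℝ}
    (hM : ∀ x y, F x + G y = r ^ 2 / 2 → 0 ≤ σ * M F G x y) (θ : ℝ) :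
    0 ≤ σ * periodDerivDensity f g (r * Real.sin θ) (r * Real.cos θ) := by
  have hc : Continuous fun θ =>
      σ * periodDerivDensity f g (r * Real.sin θ) (r * Real.cos θ) :=
    continuous_const.mul ((continuous_periodDerivDensity hf.smooth hg.smooth).comp
      (by fun_prop : Continuous fun θ => (r * Real.sin θ, r * Real.cos θ)))
  -- On the axes the factor F'⁴G'² vanishes and the identity gives no sign; continuity in θ extends
  -- the inequality from the dense set of remaining angles.
  refine (isClosed_le continuous_const hc).closure_subset_iff.2 ?_
    (dense_sin_mul_cos_ne_zero θ)
  intro θ hθ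
  have hs : Real.sin θ ≠ 0 := left_ne_zero_of_mul hθ
  have hc : Real.cos θ ≠ 0 := right_ne_zero_of_mul hθ
  have hu : |r * Real.sin θ| < ρ := abs_mul_sin_lt hr hrρ θ
  have hv : |r * Real.cos θ| < ρ := abs_mul_cos_lt hr hrρ θ
  have h1 := two_mul_M_eq hF hG hf hg hu hv
  have h2 := hM (f (r * Real.sin θ)) (g (r * Real.cos θ)) (by
    rw [hf.eq_sq _ hu, hg.eq_sq _ hv]
    linear_combination r ^ 2 / 2 * Real.sin_sq_add_cos_sq θ)
  have h3 := hf.deriv_pos _ hu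
  have h4 := hg.deriv_pos _ hv
  have h5 : deriv F (f (r * Real.sin θ)) ≠ 0 := fun h => by
    have := hf.deriv_mul hF hu
    rw [h, zero_mul] at this
    exact mul_ne_zero hr.ne' hs this.symm
  have h6 : deriv G (g (r * Real.cos θ)) ≠ 0 := fun h => by
    have := hg.deriv_mul hG hv
    rw [h, zero_mul] at this
    exact mul_ne_zero hr.ne' hc this.symm
  have h7 : 0 ≤ (deriv F (f (r * Real.sin θ)) ^ 4 * deriv G (g (r * Real.cos θ)) ^ 2) *
      (σ * periodDerivDensity f g (r * Real.sin θ) (r * Real.cos θ)) := by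
    rw [mul_left_comm, ← h1, mul_left_comm]
    positivity
  exact (mul_nonneg_iff_of_pos_left (by positivity)).1 h7

/-! ### Solutions as motion of the angle -/

/-- `p` can be joined to the origin along both coordinates by climbing segments. -/
structure InBox (F G : ℝ → ℝ) (p : ℝ × ℝ) : Prop where
  fst : Rises F p.1
  fst_mirror : Rises (mirror F) (-p.1)
  snd : Rises G p.2
  snd_mirror : Rises (mirror G) (-p.2)

/-- The set of times of agreement is closed by continuity and open by local uniqueness for a locally
Lipschitz field. -/
theorem IsSolution.eq_of_eq {F G : ℝ → ℝ} (hF : IsWell F) (hG : IsWell G) {γ δ : ℝ → ℝ × ℝ}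
    (hγ : IsSolution F G γ) (hδ : IsSolution F G δ) {t₀ : ℝ} (h : γ t₀ = δ t₀) : γ = δ := by
  let v : ℝ × ℝ → ℝ × ℝ := fun p => (deriv G p.2, -deriv F p.1)
  have hv : ContDiff ℝ ∞ v :=
    (hG.smooth_deriv.comp contDiff_snd).prodMk (hF.smooth_deriv.comp contDiff_fst).neg
  have hcγ : Continuous γ := continuous_iff_continuousAt.2 fun t => (hγ t).continuousAt
  have hcδ : Continuous δ := continuous_iff_continuousAt.2 fun t => (hδ t).continuousAt
  have hclopen : IsClopen {t | γ t = δ t} := by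
    refine ⟨isClosed_eq hcγ hcδ, isOpen_iff_mem_nhds.2 fun t ht => ?_⟩
    have ht : γ t = δ t := ht
    obtain ⟨K, s, hs, hK⟩ := (hv.of_le (by simp) : ContDiff ℝ 1 v).contDiffAt.exists_lipschitzOnWith
      (x := γ t)
    exact ODE_solution_unique_of_eventually (v := fun _ => v) (s := fun _ => s) (K := K)
      (Eventually.of_forall fun _ => hK)
      ((hcγ.continuousAt.eventually hs).mono fun a ha => ⟨hγ a, ha⟩)
      ((hcδ.continuousAt.eventually (ht ▸ hs)).mono fun a ha => ⟨hδ a, ha⟩) ht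
  have := hclopen.eq_univ ⟨t₀, h⟩
  exact funext fun t => this.symm.subset (mem_univ t)

theorem isSolution_iff {F G : ℝ → ℝ} {γ : ℝ → ℝ × ℝ} :
    IsSolution F G γ ↔ (∀ t, HasDerivAt (fun t => (γ t).1) (deriv G (γ t).2) t) ∧
      ∀ t, HasDerivAt (fun t => (γ t).2) (-deriv F (γ t).1) t := by
  refine ⟨fun h => ⟨fun t => ?_, fun t => ?_⟩, fun h t => (h.1 t).prodMk (h.2 t)⟩
  · exact (hasFDerivAt_fst (𝕜 := ℝ) (p := γ t)).comp_hasDerivAt t (h t)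
  · exact (hasFDerivAt_snd (𝕜 := ℝ) (p := γ t)).comp_hasDerivAt t (h t)

theorem IsSolution.energy_eq {F G : ℝ → ℝ} (hF : IsWell F) (hG : IsWell G) {γ : ℝ → ℝ × ℝ}
    (hγ : IsSolution F G γ) (s t : ℝ) : energy F G (γ s) = energy F G (γ t) := by
  obtain ⟨h1, h2⟩ := isSolution_iff.1 hγ
  have h : ∀ t, HasDerivAt (fun t => energy F G (γ t)) 0 t := fun t => by
    refine (((hF.hasDerivAt _).comp t (h1 t)).add ((hG.hasDerivAt _).comp t (h2 t))).congr_deriv ?_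
    ring
  exact is_const_of_deriv_eq_zero (fun t => (h t).differentiableAt) (fun t => (h t).deriv) s t

/-- The point of the level curve of energy `r ^ 2 / 2` with angle `θ`. -/
def levelPoint (f g : ℝ → ℝ) (r θ : ℝ) : ℝ × ℝ := (f (r * Real.sin θ), g (r * Real.cos θ))

/-- `φ` is the angle as a function of time along an orbit on the circle of radius `r`. -/
structure IsPhase (f g : ℝ → ℝ) (r : ℝ) (φ : ℝ → ℝ) : Prop where
  hasDerivAt : ∀ t, HasDerivAt φ (timeDensity f g r (φ t))⁻¹ t
  strictMono : StrictMono φ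
  surj : Function.Surjective φ
  add_period : ∀ (t : ℝ) (k : ℤ), φ (t + k * periodIntegral f g r) = φ t + k * (2 * Real.pi)

theorem IsPhase.comp_add {f g : ℝ → ℝ} {r : ℝ} {φ : ℝ → ℝ} (h : IsPhase f g r φ) (c : ℝ) :
    IsPhase f g r fun t => φ (t + c) where
  hasDerivAt t := (h.hasDerivAt (t + c)).comp_add_const t c
  strictMono := h.strictMono.comp fun _ _ hst => by simpa using hst
  surj := h.surj.comp (add_right_surjective c)
  add_period t k := by rw [← h.add_period]; ring_nf

section charts

variable {F G f g : ℝ → ℝ} {ρ r : ℝ}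

theorem timeDensity_pos (hf : IsChart F ρ f) (hg : IsChart G ρ g) (hr : 0 < r) (hrρ : r < ρ)
    (θ : ℝ) : 0 < timeDensity f g r θ :=
  mul_pos (hf.deriv_pos _ (abs_mul_sin_lt hr hrρ θ)) (hg.deriv_pos _ (abs_mul_cos_lt hr hrρ θ))

theorem continuous_timeDensity (hf : IsChart F ρ f) (hg : IsChart G ρ g) :
    Continuous (timeDensity f g r) := by
  have h1 := (contDiff_infty_iff_deriv.1 hf.smooth).2.continuous
  have h2 := (contDiff_infty_iff_deriv.1 hg.smooth).2.continuous
  unfold timeDensity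
  fun_prop

theorem periodIntegral_pos (hf : IsChart F ρ f) (hg : IsChart G ρ g) (hr : 0 < r) (hrρ : r < ρ) :
    0 < periodIntegral f g r :=
  intervalIntegral.intervalIntegral_pos_of_pos
    ((continuous_timeDensity hf hg).intervalIntegrable _ _) (timeDensity_pos hf hg hr hrρ)
    Real.two_pi_pos

/-- Elapsed time τ(θ) is an increasing bijection of the line, since its derivative is positive and
each full turn adds the same positive amount; the phase is its inverse. -/
theorem exists_isPhase (hf : IsChart F ρ f) (hg : IsChart G ρ g) (hr : 0 < r) (hrρ : r < ρ) :
    ∃ φ, IsPhase f g r φ := by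
  have hc := continuous_timeDensity (r := r) hf hg
  have hT := periodIntegral_pos hf hg hr hrρ
  let τ : ℝ → ℝ := fun θ => ∫ s in (0 : ℝ)..θ, timeDensity f g r s
  have hτ : ∀ θ, HasDerivAt τ (timeDensity f g r θ) θ := fun θ => hc.integral_hasStrictDerivAt 0 θ
    |>.hasDerivAt
  have hmono : StrictMono τ := strictMono_of_hasDerivAt_pos hτ (timeDensity_pos hf hg hr hrρ)
  have hτc : Continuous τ := continuous_iff_continuousAt.2 fun θ => (hτ θ).continuousAt
  have hper : Function.Periodic (timeDensity f g r) (2 * Real.pi) := fun θ => by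
    simp [timeDensity]
  have hadd : ∀ (θ : ℝ) (k : ℤ), τ (θ + k * (2 * Real.pi)) = τ θ + k * periodIntegral f g r := by
    -- Removing the mean slope leaves a periodic function, which handles all integer numbers of
    -- turns at once.
    have h1 : Function.Periodic (fun θ => τ θ - θ * (periodIntegral f g r / (2 * Real.pi)))
        (2 * Real.pi) := fun θ => by
      have h2 : τ (θ + 2 * Real.pi) = τ θ + periodIntegral f g r := by
        have h3 := hper.intervalIntegral_add_eq θ 0
        rw [zero_add] at h3
        rw [periodIntegral, ← h3]
        exact (intervalIntegral.integral_add_adjacent_intervals (hc.intervalIntegrable _ _)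
          (hc.intervalIntegrable _ _)).symm
      simp only [h2]
      field_simp
      ring
    intro θ k
    have h2 := h1.int_mul k θ
    beta_reduce at h2
    have h3 : k * (2 * Real.pi) * (periodIntegral f g r / (2 * Real.pi)) =
        k * periodIntegral f g r := by field_simp
    linear_combination h2 + h3
  have hsurj : Function.Surjective τ := by
    intro s
    obtain ⟨n, hn⟩ := exists_nat_gt (|s| / periodIntegral f g r)
    rw [div_lt_iff₀ hT] at hn
    have h0 : τ 0 = 0 := intervalIntegral.integral_same
    have h1 := hadd 0 n
    have h2 := hadd 0 (-n)
    rw [h0] at h1 h2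
    push_cast at h1 h2
    have h3 : (n : ℝ) * (2 * Real.pi) ≥ 0 := by positivity
    have h4 := intermediate_value_Icc (by linarith :
      0 + -(n : ℝ) * (2 * Real.pi) ≤ 0 + n * (2 * Real.pi)) hτc.continuousOn
    rw [h1, h2] at h4
    obtain ⟨θ, -, hθ⟩ := h4 (show s ∈ Icc _ _ from
      ⟨by linarith [neg_abs_le s], by linarith [le_abs_self s]⟩)
    exact ⟨θ, hθ⟩
  let e : ℝ ≃o ℝ := hmono.orderIsoOfSurjective τ hsurj
  have he : ∀ t, τ (e.symm t) = t := fun t => e.apply_symm_apply t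
  refine ⟨e.symm, fun t => ?_, e.symm.strictMono, e.symm.surjective, fun t k => ?_⟩
  · exact HasDerivAt.of_local_left_inverse e.symm.continuous.continuousAt (hτ _)
      (timeDensity_pos hf hg hr hrρ _).ne' (Eventually.of_forall he)
  · apply hmono.injective
    rw [hadd, he, he]

theorem isSolution_levelPoint_comp (hF : IsWell F) (hG : IsWell G) (hf : IsChart F ρ f)
    (hg : IsChart G ρ g) (hr : 0 < r) (hrρ : r < ρ) {φ : ℝ → ℝ} (h : IsPhase f g r φ) :
    IsSolution F G fun t => levelPoint f g r (φ t) := by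
  refine isSolution_iff.2 ⟨fun t => ?_, fun t => ?_⟩
  · have h1 := (hasDerivAt_of_smooth hf.smooth _).comp t
      (((Real.hasDerivAt_sin (φ t)).comp t (h.hasDerivAt t)).const_mul r)
    refine h1.congr_deriv ?_
    have h2 := hg.deriv_mul hG (abs_mul_cos_lt hr hrρ (φ t))
    have h3 := hg.deriv_pos _ (abs_mul_cos_lt hr hrρ (φ t))
    have h4 := hf.deriv_pos _ (abs_mul_sin_lt hr hrρ (φ t))
    simp only [timeDensity, levelPoint, Function.comp]
    field_simp
    linarith
  · have h1 := (hasDerivAt_of_smooth hg.smooth _).comp t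
      (((Real.hasDerivAt_cos (φ t)).comp t (h.hasDerivAt t)).const_mul r)
    refine h1.congr_deriv ?_
    have h2 := hf.deriv_mul hF (abs_mul_sin_lt hr hrρ (φ t))
    have h3 := hg.deriv_pos _ (abs_mul_cos_lt hr hrρ (φ t))
    have h4 := hf.deriv_pos _ (abs_mul_sin_lt hr hrρ (φ t))
    simp only [timeDensity, levelPoint, Function.comp]
    field_simp
    linarith

theorem energy_levelPoint (hf : IsChart F ρ f) (hg : IsChart G ρ g) (hr : 0 < r) (hrρ : r < ρ)
    (θ : ℝ) : energy F G (levelPoint f g r θ) = r ^ 2 / 2 := by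
  simp only [energy, levelPoint]
  rw [hf.eq_sq _ (abs_mul_sin_lt hr hrρ θ), hg.eq_sq _ (abs_mul_cos_lt hr hrρ θ)]
  linear_combination r ^ 2 / 2 * Real.sin_sq_add_cos_sq θ

theorem inBox_levelPoint (hf : IsChart F ρ f) (hg : IsChart G ρ g) (hr : 0 < r) (hrρ : r < ρ)
    (θ : ℝ) : InBox F G (levelPoint f g r θ) :=
  ⟨hf.rises _ (abs_mul_sin_lt hr hrρ θ), hf.rises_mirror _ (abs_mul_sin_lt hr hrρ θ),
    hg.rises _ (abs_mul_cos_lt hr hrρ θ), hg.rises_mirror _ (abs_mul_cos_lt hr hrρ θ)⟩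

theorem IsChart.injOn (hf : IsChart F ρ f) : InjOn f (Ioo (-ρ) ρ) := by
  refine (strictMonoOn_of_deriv_pos (convex_Ioo _ _) hf.smooth.continuous.continuousOn ?_).injOn
  rw [interior_Ioo]
  exact fun u hu => hf.deriv_pos u (abs_lt.2 hu)

theorem levelPoint_eq_iff (hf : IsChart F ρ f) (hg : IsChart G ρ g) (hr : 0 < r) (hrρ : r < ρ)
    {θ ψ : ℝ} : levelPoint f g r θ = levelPoint f g r ψ ↔ ∃ k : ℤ, θ = ψ + k * (2 * Real.pi) := by
  constructor
  · intro h
    obtain ⟨h1, h2⟩ := Prod.ext_iff.1 h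
    have h3 := hf.injOn (abs_lt.1 (abs_mul_sin_lt hr hrρ θ)) (abs_lt.1 (abs_mul_sin_lt hr hrρ ψ)) h1
    have h4 := hg.injOn (abs_lt.1 (abs_mul_cos_lt hr hrρ θ)) (abs_lt.1 (abs_mul_cos_lt hr hrρ ψ)) h2
    obtain ⟨k, hk⟩ := Real.Angle.angle_eq_iff_two_pi_dvd_sub.1 (Real.Angle.cos_sin_inj
      (mul_left_cancel₀ hr.ne' h4) (mul_left_cancel₀ hr.ne' h3))
    exact ⟨k, by linarith⟩
  · rintro ⟨k, rfl⟩
    simp [levelPoint, Real.sin_add_int_mul_two_pi, Real.cos_add_int_mul_two_pi]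

theorem exists_levelPoint_eq (hF : IsWell F) (hG : IsWell G) (hf : IsChart F ρ f)
    (hg : IsChart G ρ g) (hr : 0 < r) (hrρ : r < ρ) {p : ℝ × ℝ} (hp : InBox F G p)
    (hE : energy F G p = r ^ 2 / 2) : ∃ θ, levelPoint f g r θ = p := by
  have h1 := hF.nonneg_of_rises hp.fst hp.fst_mirror
  have h2 := hG.nonneg_of_rises hp.snd hp.snd_mirror
  have h3 : r ^ 2 / 2 < ρ ^ 2 / 2 := by nlinarith
  unfold energy at hE
  obtain ⟨u, hu, hup⟩ := hf.surj p.1 hp.fst hp.fst_mirror (by linarith)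
  obtain ⟨v, hv, hvp⟩ := hg.surj p.2 hp.snd hp.snd_mirror (by linarith)
  rw [← hup, ← hvp, hf.eq_sq u hu, hg.eq_sq v hv] at hE
  -- The cosine goes with v and the sine with u, so the angle is the argument of v + iu.
  let z : ℂ := ⟨v, u⟩
  have hz : ‖z‖ = r := by
    rw [Complex.norm_eq_sqrt_sq_add_sq, show z.re ^ 2 + z.im ^ 2 = r ^ 2 by simp only [z]; linarith,
      Real.sqrt_sq hr.le]
  refine ⟨z.arg, ?_⟩
  rw [levelPoint, ← hz, Complex.norm_mul_sin_arg, Complex.norm_mul_cos_arg]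
  exact Prod.ext hup hvp

theorem exists_isPhase_eq (hF : IsWell F) (hG : IsWell G) (hf : IsChart F ρ f)
    (hg : IsChart G ρ g) (hr : 0 < r) (hrρ : r < ρ) {γ : ℝ → ℝ × ℝ} (hγ : IsSolution F G γ)
    (hp : InBox F G (γ 0)) (hE : energy F G (γ 0) = r ^ 2 / 2) :
    ∃ φ, IsPhase f g r φ ∧ γ = fun t => levelPoint f g r (φ t) := by
  obtain ⟨θ, hθ⟩ := exists_levelPoint_eq hF hG hf hg hr hrρ hp hE
  obtain ⟨φ, hφ⟩ := exists_isPhase hf hg hr hrρ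
  obtain ⟨c, rfl⟩ := hφ.surj θ
  refine ⟨_, hφ.comp_add c, hγ.eq_of_eq hF hG
    (isSolution_levelPoint_comp hF hG hf hg hr hrρ (hφ.comp_add c)) (t₀ := 0) ?_⟩
  rw [zero_add, hθ]

theorem isMinimalPeriod_levelPoint_comp (hf : IsChart F ρ f) (hg : IsChart G ρ g) (hr : 0 < r)
    (hrρ : r < ρ) {φ : ℝ → ℝ} (h : IsPhase f g r φ) :
    IsMinimalPeriod (fun t => levelPoint f g r (φ t)) (periodIntegral f g r) := by
  have hT := periodIntegral_pos hf hg hr hrρ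
  refine ⟨⟨hT, fun t => ?_⟩, fun s ⟨hs, hper⟩ => ?_⟩
  · refine (levelPoint_eq_iff hf hg hr hrρ).2 ⟨1, ?_⟩
    simpa using h.add_period t 1
  -- Any period advances the angle by a whole number k of turns, hence equals k times the period
  -- integral; positivity forces k ≥ 1.
  · obtain ⟨k, hk⟩ := (levelPoint_eq_iff hf hg hr hrρ).1 (hper 0)
    rw [← h.add_period] at hk
    have hk := h.strictMono.injective hk
    rw [zero_add, zero_add] at hk
    have h1 : 0 < k := by
      by_contra h2
      have : (k : ℝ) ≤ 0 := by exact_mod_cast not_lt.1 h2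
      nlinarith
    have : (1 : ℝ) ≤ k := by exact_mod_cast h1
    nlinarith

end charts

/-! ### Points of the period annulus have good energy -/

/-- All four half-axes climb up to the energy `E`. -/
structure IsGood (F G : ℝ → ℝ) (E : ℝ) : Prop where
  fst : Attains F E
  fst_mirror : Attains (mirror F) E
  snd : Attains G E
  snd_mirror : Attains (mirror G) E

theorem IsWell.eventually_rises {f : ℝ → ℝ} (hf : IsWell f) {x : ℝ} (h : Rises f x) :
    ∀ᶠ y in 𝓝 x, Rises f y := by
  rcases lt_or_ge x 0 with hx | hx
  · filter_upwards [gt_mem_nhds hx] with y hy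
    exact rises_of_nonpos (le_of_lt hy)
  · obtain ⟨c, hc, hr⟩ := hf.exists_rises_gt hx h
    filter_upwards [gt_mem_nhds hc] with y hy
    exact hr.mono (le_of_lt hy)

theorem IsWell.isOpen_rises {f : ℝ → ℝ} (hf : IsWell f) : IsOpen {x | Rises f x} :=
  isOpen_iff_mem_nhds.2 fun _ hx => hf.eventually_rises hx

/-- A limit position at which `f` climbs strictly below `x` only is either climbing at `x` too,
or a critical point carrying the whole energy. -/
theorem IsWell.rises_of_limit {f : ℝ → ℝ} (hf : IsWell f) {x c E : ℝ}
    (hx : ∀ s, 0 < s → s < x → 0 < deriv f s) (hA : ∀ E', 0 ≤ E' → E' < E → Attains f E')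
    (hc : 0 ≤ c) (hE : f x + c = E) (hcrit : ¬(c = 0 ∧ deriv f x = 0)) : Rises f x := by
  rcases le_or_gt x 0 with h0 | h0
  · exact rises_of_nonpos h0
  by_contra hr
  have hfx : 0 < f x := by
    have := hf.strictMonoOn_of_pos hx ⟨le_rfl, h0.le⟩ ⟨h0.le, le_rfl⟩ h0
    rwa [hf.zero] at this
  -- Otherwise a level strictly between f(x) and E is attained, which puts x on the climbing branch.
  -- So x carries all the energy, c = 0, and f'(x) is both nonpositive and a limit of positive
  -- values.
  have h1 : E ≤ f x := by
    by_contra h2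
    obtain ⟨E', h3, h4⟩ := exists_between (not_le.1 h2)
    exact hr (hf.rises_of_attains (hA E' (hfx.le.trans h3.le) h4) hx h3)
  refine hcrit ⟨by linarith, ?_⟩
  have h2 : deriv f x ≤ 0 := by
    by_contra h3
    refine hr fun s hs hsx => ?_
    rcases hsx.eq_or_lt with rfl | hsx
    · exact not_le.1 h3
    · exact hx s hs hsx
  refine le_antisymm h2 (le_of_not_gt fun h3 => ?_)
  have h4 : ∀ᶠ s in 𝓝[<] x, deriv f s < 0 :=
    (hf.smooth_deriv.continuous.continuousAt.eventually (gt_mem_nhds h3)).filter_mono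
      nhdsWithin_le_nhds
  obtain ⟨s, h5, h6⟩ := (h4.and (Ioo_mem_nhdsLT h0)).exists
  exact absurd (hx s h6.1 h6.2) (not_lt.2 h5.le)

/-- A periodic, nonstationary orbit of energy `E`, all smaller energies being good. -/
structure IsLimitOrbit (F G : ℝ → ℝ) (γ : ℝ → ℝ × ℝ) (E : ℝ) : Prop where
  wellF : IsWell F
  wellG : IsWell G
  sol : IsSolution F G γ
  periodic : ∃ τ, 0 < τ ∧ Function.Periodic γ τ
  noncrit : ∀ t, ¬(deriv F (γ t).1 = 0 ∧ deriv G (γ t).2 = 0)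
  energy_eq : ∀ t, F (γ t).1 + G (γ t).2 = E
  good : ∀ E', 0 ≤ E' → E' < E → IsGood F G E'

/-- The quarter turn of a curve. -/
def turn (γ : ℝ → ℝ × ℝ) : ℝ → ℝ × ℝ := fun t => (-(γ t).2, (γ t).1)

/-- The rotation (x, y) ↦ (-y, x) carries the system of F(x) + G(y) to that of G(-x) + F(y), so one
quadrant suffices for all four. -/
theorem IsLimitOrbit.turn {F G : ℝ → ℝ} {γ : ℝ → ℝ × ℝ} {E : ℝ} (h : IsLimitOrbit F G γ E) :
    IsLimitOrbit (mirror G) F (turn γ) E where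
  wellF := h.wellG.mirror
  wellG := h.wellF
  sol := by
    obtain ⟨h1, h2⟩ := isSolution_iff.1 h.sol
    refine isSolution_iff.2 ⟨fun t => (h2 t).neg.congr_deriv (neg_neg _), fun t => ?_⟩
    refine (h1 t).congr_deriv ?_
    simp [SeparableHamiltonian.turn, deriv_mirror]
  periodic := by
    obtain ⟨τ, h0, h1⟩ := h.periodic
    exact ⟨τ, h0, fun t => by simp [SeparableHamiltonian.turn, h1 t]⟩
  noncrit t := by
    have := h.noncrit t
    simp only [SeparableHamiltonian.turn, deriv_mirror, neg_neg, neg_eq_zero]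
    tauto
  energy_eq t := by
    simp only [SeparableHamiltonian.turn, mirror_apply, neg_neg]
    rw [add_comm]
    exact h.energy_eq t
  good E' h0 h1 := by
    obtain ⟨a, b, c, d⟩ := h.good E' h0 h1
    exact ⟨d, by rwa [mirror_mirror], a, b⟩

/-- The orbit visits the climbing part of the quadrant `0 ≤ x`, `0 < y`. -/
def MeetsQuadrant (F G : ℝ → ℝ) (γ : ℝ → ℝ × ℝ) : Prop :=
  ∃ t, 0 ≤ (γ t).1 ∧ 0 < (γ t).2 ∧ Rises F (γ t).1 ∧ Rises G (γ t).2

/-- While the orbit stays in the climbing quadrant, x increases and y decreases. It must leave, by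
periodicity. At the first exit y ≥ 0 and both coordinates are still on climbing branches, so the
exit can only be through y = 0. -/
theorem IsLimitOrbit.exists_on_axis {F G : ℝ → ℝ} {γ : ℝ → ℝ × ℝ} {E : ℝ}
    (h : IsLimitOrbit F G γ E) (hq : MeetsQuadrant F G γ) :
    ∃ t, 0 < (γ t).1 ∧ (γ t).2 = 0 ∧ Rises F (γ t).1 := by
  obtain ⟨t₀, hx0, hy0, hFx0, hGy0⟩ := hq
  obtain ⟨hdx, hdy⟩ := isSolution_iff.1 h.sol
  have hcx : Continuous fun t => (γ t).1 := continuous_iff_continuousAt.2 fun t =>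
    (hdx t).continuousAt
  have hcy : Continuous fun t => (γ t).2 := continuous_iff_continuousAt.2 fun t =>
    (hdy t).continuousAt
  let V : Set ℝ := {t | 0 < (γ t).2 ∧ Rises F (γ t).1 ∧ Rises G (γ t).2}
  have hV : IsOpen V := (isOpen_lt continuous_const hcy).inter
    ((h.wellF.isOpen_rises.preimage hcx).inter (h.wellG.isOpen_rises.preimage hcy))
  have hxmono : ∀ t, (∀ s, t₀ ≤ s → s < t → s ∈ V) →
      StrictMonoOn (fun t => (γ t).1) (Icc t₀ t) := by
    intro t ht
    refine strictMonoOn_of_deriv_pos (convex_Icc _ _) hcx.continuousOn fun s hs => ?_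
    rw [interior_Icc] at hs
    rw [(hdx s).deriv]
    obtain ⟨h1, -, h2⟩ := ht s hs.1.le hs.2
    exact h2 _ h1 le_rfl
  set S : Set ℝ := Ici t₀ ∩ Vᶜ with hS
  have hSc : IsClosed S := isClosed_Ici.inter hV.isClosed_compl
  rcases S.eq_empty_or_nonempty with hSe | hSn
  · exfalso
    obtain ⟨τ, hτ, hper⟩ := h.periodic
    have h1 := hxmono (t₀ + τ) (fun s hs _ => by
      by_contra hsV
      exact hSe.subset ⟨hs, hsV⟩) ⟨le_rfl, by linarith⟩ ⟨by linarith, le_rfl⟩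
      (by linarith : t₀ < t₀ + τ)
    simp [hper t₀] at h1
  have hbdd : BddBelow S := ⟨t₀, fun s hs => hs.1⟩
  obtain ⟨h1, h2⟩ := hSc.csInf_mem hSn hbdd
  have hlt : ∀ s, t₀ ≤ s → s < sInf S → s ∈ V := fun s hs hsS => by
    by_contra hsV
    exact absurd (csInf_le hbdd ⟨hs, hsV⟩) (not_le.2 hsS)
  generalize sInf S = t₁ at h1 h2 hlt
  have h01 : t₀ < t₁ := by
    refine lt_of_le_of_ne h1 ?_
    rintro rfl
    exact h2 ⟨hy0, hFx0, hGy0⟩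
  have hx := hxmono t₁ hlt
  have hyanti : AntitoneOn (fun t => (γ t).2) (Icc t₀ t₁) := by
    refine antitoneOn_of_deriv_nonpos (convex_Icc _ _) hcy.continuousOn
      (fun s _ => (hdy s).differentiableAt.differentiableWithinAt) fun s hs => ?_
    rw [interior_Icc] at hs
    rw [(hdy s).deriv, neg_nonpos]
    have h3 : (γ t₀).1 < (γ s).1 := hx ⟨le_rfl, h1⟩ ⟨hs.1.le, hs.2.le⟩ hs.1
    exact ((hlt s hs.1.le hs.2).2.1 _ (hx0.trans_lt h3) le_rfl).le
  have hx1 : (γ t₀).1 < (γ t₁).1 := hx ⟨le_rfl, h1⟩ ⟨h1, le_rfl⟩ h01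
  have hG1 : Rises G (γ t₁).2 := hGy0.mono (hyanti ⟨le_rfl, h1⟩ ⟨h1, le_rfl⟩ h1)
  have hy1 : 0 ≤ (γ t₁).2 := by
    by_contra h3
    have h4 : ∀ᶠ s in 𝓝[<] t₁, (γ s).2 < 0 :=
      (hcy.continuousAt.eventually (gt_mem_nhds (not_le.1 h3))).filter_mono nhdsWithin_le_nhds
    obtain ⟨s, h5, h6⟩ := (h4.and (Ioo_mem_nhdsLT h01)).exists
    exact absurd (hlt s h6.1.le h6.2).1 (not_lt.2 h5.le)
  have hweak : ∀ s, 0 < s → s < (γ t₁).1 → 0 < deriv F s := by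
    intro s hs hsx
    have h4 : ∀ᶠ a in 𝓝[<] t₁, s < (γ a).1 :=
      (hcx.continuousAt.eventually (lt_mem_nhds hsx)).filter_mono nhdsWithin_le_nhds
    obtain ⟨a, h5, h6⟩ := (h4.and (Ioo_mem_nhdsLT h01)).exists
    exact (hlt a h6.1.le h6.2).2.1 s hs h5.le
  have hGnn : 0 ≤ G (γ t₁).2 :=
    h.wellG.nonneg_of_rises hG1 (rises_of_nonpos (by linarith))
  have hF1 : Rises F (γ t₁).1 := by
    -- In the excluded case G(y) = 0 forces y = 0, so the orbit would pass through a critical point.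
    refine h.wellF.rises_of_limit hweak (fun E' h0 h3 => (h.good E' h0 h3).fst) hGnn
      (h.energy_eq t₁) fun h3 => h.noncrit t₁ ⟨h3.2, ?_⟩
    rcases hy1.eq_or_lt with h4 | h4
    · rw [← h4, h.wellG.deriv_zero]
    · exact absurd h3.1 (h.wellG.pos_of_rises hG1 h4).ne'
  refine ⟨t₁, by linarith, ?_, hF1⟩
  rcases hy1.eq_or_lt with h4 | h4
  · exact h4.symm
  · exact absurd ⟨h4, hF1, hG1⟩ h2

theorem IsLimitOrbit.attains_and_meetsQuadrant_turn {F G : ℝ → ℝ} {γ : ℝ → ℝ × ℝ} {E : ℝ}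
    (h : IsLimitOrbit F G γ E) (hq : MeetsQuadrant F G γ) :
    Attains F E ∧ MeetsQuadrant (mirror G) F (SeparableHamiltonian.turn γ) := by
  obtain ⟨t, hx, hy, hr⟩ := h.exists_on_axis hq
  have hE := h.energy_eq t
  rw [hy, h.wellG.zero, add_zero] at hE
  refine ⟨⟨_, hx.le, hE, hr⟩, t, ?_, hx, ?_, hr⟩
  · simp [SeparableHamiltonian.turn, hy]
  · exact rises_of_nonpos (by simp [SeparableHamiltonian.turn, hy])

/-- The crossing of each half-axis is a valid starting point for the next quadrant, so four quarter
turns reach the four half-axes, each crossed where one coordinate carries the energy E. -/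
theorem IsLimitOrbit.isGood_of_meetsQuadrant {F G : ℝ → ℝ} {γ : ℝ → ℝ × ℝ} {E : ℝ}
    (h : IsLimitOrbit F G γ E) (hq : MeetsQuadrant F G γ) : IsGood F G E := by
  obtain ⟨a1, q1⟩ := h.attains_and_meetsQuadrant_turn hq
  obtain ⟨a2, q2⟩ := h.turn.attains_and_meetsQuadrant_turn q1
  obtain ⟨a3, q3⟩ := h.turn.turn.attains_and_meetsQuadrant_turn q2
  obtain ⟨a4, -⟩ := h.turn.turn.turn.attains_and_meetsQuadrant_turn q3
  rw [mirror_mirror] at a4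
  exact ⟨a1, a3, a4, a2⟩

theorem IsGood.of_turn {F G : ℝ → ℝ} {E : ℝ} (h : IsGood (mirror G) F E) : IsGood F G E := by
  obtain ⟨a, b, c, d⟩ := h
  rw [mirror_mirror] at b
  exact ⟨c, d, b, a⟩

theorem IsLimitOrbit.isGood {F G : ℝ → ℝ} {γ : ℝ → ℝ × ℝ} {E t : ℝ}
    (h : IsLimitOrbit F G γ E) (hp : InBox F G (γ t)) (h0 : γ t ≠ 0) : IsGood F G E := by
  obtain ⟨hF, hF', hG, hG'⟩ := hp
  by_cases h1 : 0 ≤ (γ t).1 ∧ 0 < (γ t).2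
  · exact h.isGood_of_meetsQuadrant ⟨t, h1.1, h1.2, hF, hG⟩
  by_cases h2 : 0 ≤ -(γ t).2 ∧ 0 < (γ t).1
  · exact (h.turn.isGood_of_meetsQuadrant ⟨t, h2.1, h2.2, hG', hF⟩).of_turn
  by_cases h3 : 0 ≤ -(γ t).1 ∧ 0 < -(γ t).2
  · exact (h.turn.turn.isGood_of_meetsQuadrant ⟨t, h3.1, h3.2, hF', hG'⟩).of_turn.of_turn
  have h4 : 0 ≤ (γ t).2 ∧ 0 < -(γ t).1 := by
    by_contra h4
    refine h0 (Prod.ext ?_ ?_) <;> simp only [Prod.fst_zero, Prod.snd_zero] <;> grind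
  refine (h.turn.turn.turn.isGood_of_meetsQuadrant ⟨t, ?_, h4.2, ?_, hF'⟩).of_turn.of_turn.of_turn
  · simpa [SeparableHamiltonian.turn] using h4.1
  · rw [mirror_mirror]
    simpa [SeparableHamiltonian.turn] using hG

theorem isOpen_inBox {F G : ℝ → ℝ} (hF : IsWell F) (hG : IsWell G) : IsOpen {p | InBox F G p} := by
  have h : {p : ℝ × ℝ | InBox F G p} = ((fun p => p.1) ⁻¹' {x | Rises F x} ∩
      (fun p => -p.1) ⁻¹' {x | Rises (mirror F) x}) ∩ ((fun p => p.2) ⁻¹' {x | Rises G x} ∩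
      (fun p => -p.2) ⁻¹' {x | Rises (mirror G) x}) := by
    ext p
    exact ⟨fun h => ⟨⟨h.1, h.2⟩, h.3, h.4⟩, fun h => ⟨h.1.1, h.1.2, h.2.1, h.2.2⟩⟩
  rw [h]
  exact ((hF.isOpen_rises.preimage continuous_fst).inter
    (hF.mirror.isOpen_rises.preimage continuous_fst.neg)).inter
    ((hG.isOpen_rises.preimage continuous_snd).inter
    (hG.mirror.isOpen_rises.preimage continuous_snd.neg))

theorem continuous_energy {F G : ℝ → ℝ} (hF : IsWell F) (hG : IsWell G) :
    Continuous (energy F G) :=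
  (hF.continuous.comp continuous_fst).add (hG.continuous.comp continuous_snd)

theorem InBox.energy_nonneg {F G : ℝ → ℝ} (hF : IsWell F) (hG : IsWell G) {p : ℝ × ℝ}
    (hp : InBox F G p) : 0 ≤ energy F G p :=
  add_nonneg (hF.nonneg_of_rises hp.fst hp.fst_mirror) (hG.nonneg_of_rises hp.snd hp.snd_mirror)

theorem IsGood.mono {F G : ℝ → ℝ} (hF : IsWell F) (hG : IsWell G) {E E' : ℝ} (h : IsGood F G E)
    (h0 : 0 ≤ E') (hE : E' ≤ E) : IsGood F G E' :=
  ⟨hF.attains_mono h.1 h0 hE, hF.mirror.attains_mono h.2 h0 hE, hG.attains_mono h.3 h0 hE,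
    hG.mirror.attains_mono h.4 h0 hE⟩

theorem IsGood.exists_gt {F G : ℝ → ℝ} (hF : IsWell F) (hG : IsWell G) {E : ℝ} (hE : 0 ≤ E)
    (h : IsGood F G E) : ∃ E', E < E' ∧ IsGood F G E' := by
  obtain ⟨a, ha, ha'⟩ := hF.exists_attains_gt h.1
  obtain ⟨b, hb, hb'⟩ := hF.mirror.exists_attains_gt h.2
  obtain ⟨c, hc, hc'⟩ := hG.exists_attains_gt h.3
  obtain ⟨d, hd, hd'⟩ := hG.mirror.exists_attains_gt h.4
  have hm : E < min (min a b) (min c d) := lt_min (lt_min ha hb) (lt_min hc hd)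
  have h0 := hE.trans hm.le
  exact ⟨_, hm, hF.attains_mono ha' h0 (by simp), hF.mirror.attains_mono hb' h0 (by simp),
    hG.attains_mono hc' h0 (by simp), hG.mirror.attains_mono hd' h0 (by simp)⟩

theorem IsWell.nonneg_of_limit {f : ℝ → ℝ} (hf : IsWell f) {x : ℝ}
    (h : ∀ s, 0 < s → s < x → 0 < deriv f s)
    (h' : ∀ s, 0 < s → s < -x → 0 < deriv (SeparableHamiltonian.mirror f) s) :
    0 ≤ f x ∧ (f x = 0 → x = 0) := by
  rcases lt_trichotomy x 0 with h0 | rfl | h0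
  · have h0' : 0 < -x := neg_pos.2 h0
    have := hf.mirror.strictMonoOn_of_pos h' ⟨le_rfl, h0'.le⟩ ⟨h0'.le, le_rfl⟩ h0'
    rw [hf.mirror.zero, mirror_apply, neg_neg] at this
    exact ⟨this.le, fun h => absurd h this.ne'⟩
  · exact ⟨hf.zero.ge, fun _ => rfl⟩
  · have := hf.strictMonoOn_of_pos h ⟨le_rfl, h0.le⟩ ⟨h0.le, le_rfl⟩ h0
    rw [hf.zero] at this
    exact ⟨this.le, fun h => absurd h this.ne'⟩

/-- The set R of such points is open and contains the origin; connectedness of U reduces the claim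
to R being closed relative to U. -/
theorem IsFilledNhd.subset_good {F G : ℝ → ℝ} (hF : IsWell F) (hG : IsWell G) {U : Set (ℝ × ℝ)}
    (hU : IsFilledNhd F G U) {p : ℝ × ℝ} (hp : p ∈ U) :
    InBox F G p ∧ IsGood F G (energy F G p) := by
  obtain ⟨-, hconn, h0U, hfill⟩ := hU
  let R : Set (ℝ × ℝ) := {p | InBox F G p ∧ IsGood F G (energy F G p)}
  have hcE := continuous_energy hF hG
  have hR : IsOpen R := by
    rw [isOpen_iff_mem_nhds]
    rintro q ⟨hq, hqE⟩
    obtain ⟨E', hE', hgood⟩ := hqE.exists_gt hF hG (hq.energy_nonneg hF hG)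
    filter_upwards [(isOpen_inBox hF hG).mem_nhds hq, hcE.continuousAt.eventually
      (gt_mem_nhds hE')] with a ha haE
    have ha : InBox F G a := ha
    exact ⟨ha, hgood.mono hF hG (ha.energy_nonneg hF hG) haE.le⟩
  have h0R : (0 : ℝ × ℝ) ∈ R := by
    have hE : energy F G 0 = 0 := by simp [energy, hF.zero, hG.zero]
    refine ⟨⟨?_, ?_, ?_, ?_⟩, ?_⟩
    · exact rises_of_nonpos (by simp)
    · exact rises_of_nonpos (by simp)
    · exact rises_of_nonpos (by simp)
    · exact rises_of_nonpos (by simp)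
    · rw [hE]
      exact ⟨hF.attains_zero, hF.mirror.attains_zero, hG.attains_zero, hG.mirror.attains_zero⟩
  refine hconn.isPreconnected.subset_of_closure_inter_subset hR ⟨0, h0U, h0R⟩ ?_ hp
  rintro q ⟨hqR, hqU⟩
  rcases eq_or_ne q 0 with rfl | hq0
  · exact h0R
  obtain ⟨O, ⟨γ, τ, hγ, hτ, hper, hne, rfl⟩, ⟨t, rfl⟩, -⟩ := hfill q hqU hq0
  have hnear : ∀ V ∈ 𝓝 (γ t), ∃ a ∈ V, a ∈ R := fun V hV => mem_closure_iff_nhds.1 hqR V hV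
  have hgood : ∀ E', 0 ≤ E' → E' < energy F G (γ t) → IsGood F G E' := by
    intro E' h0 h1
    obtain ⟨a, ha, -, haR⟩ := hnear _ (hcE.continuousAt.eventually (lt_mem_nhds h1))
    exact haR.mono hF hG h0 (le_of_lt ha)
  -- By uniqueness, a solution through a critical point is constant.
  have hnoncrit : ∀ s, ¬(deriv F (γ s).1 = 0 ∧ deriv G (γ s).2 = 0) := by
    rintro s ⟨h1, h2⟩
    have h3 : IsSolution F G fun _ => γ s := fun a => by
      simp only [h1, h2, neg_zero]
      exact hasDerivAt_const a (γ s)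
    have h4 := hγ.eq_of_eq hF hG h3 (t₀ := s) rfl
    obtain ⟨a, ha⟩ := hne
    exact ha ((congrFun h4 a).trans (congrFun h4 0).symm)
  have horb : IsLimitOrbit F G γ (energy F G (γ t)) :=
    ⟨hF, hG, hγ, ⟨τ, hτ, hper⟩, hnoncrit, fun s => hγ.energy_eq hF hG s t, hgood⟩
  -- Approximation by points of R gives climbing strictly before the limit position only; the
  -- endpoint is recovered by `rises_of_limit`.
  have w1 : ∀ s, 0 < s → s < (γ t).1 → 0 < deriv F s := by
    intro s hs hst
    obtain ⟨a, ha, haR, -⟩ := hnear _ (continuous_fst.continuousAt.eventually (lt_mem_nhds hst))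
    exact haR.fst s hs (le_of_lt ha)
  have w2 : ∀ s, 0 < s → s < -(γ t).1 → 0 < deriv (mirror F) s := by
    intro s hs hst
    obtain ⟨a, ha, haR, -⟩ := hnear _ (continuous_fst.neg.continuousAt.eventually (lt_mem_nhds hst))
    exact haR.fst_mirror s hs (le_of_lt ha)
  have w3 : ∀ s, 0 < s → s < (γ t).2 → 0 < deriv G s := by
    intro s hs hst
    obtain ⟨a, ha, haR, -⟩ := hnear _ (continuous_snd.continuousAt.eventually (lt_mem_nhds hst))
    exact haR.snd s hs (le_of_lt ha)
  have w4 : ∀ s, 0 < s → s < -(γ t).2 → 0 < deriv (mirror G) s := by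
    intro s hs hst
    obtain ⟨a, ha, haR, -⟩ := hnear _ (continuous_snd.neg.continuousAt.eventually (lt_mem_nhds hst))
    exact haR.snd_mirror s hs (le_of_lt ha)
  obtain ⟨nF, zF⟩ := hF.nonneg_of_limit w1 w2
  obtain ⟨nG, zG⟩ := hG.nonneg_of_limit w3 w4
  have hcF : ¬(G (γ t).2 = 0 ∧ deriv F (γ t).1 = 0) := fun h =>
    hnoncrit t ⟨h.2, by rw [zG h.1, hG.deriv_zero]⟩
  have hcG : ¬(F (γ t).1 = 0 ∧ deriv G (γ t).2 = 0) := fun h =>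
    hnoncrit t ⟨by rw [zF h.1, hF.deriv_zero], h.2⟩
  have hbox : InBox F G (γ t) := by
    refine ⟨?_, ?_, ?_, ?_⟩
    · exact hF.rises_of_limit w1 (fun E' a b => (hgood E' a b).1) nG rfl hcF
    · exact hF.mirror.rises_of_limit w2 (fun E' a b => (hgood E' a b).2) nG
        (by rw [mirror_apply, neg_neg]; rfl)
        (by rwa [deriv_mirror, neg_neg, neg_eq_zero])
    · exact hG.rises_of_limit w3 (fun E' a b => (hgood E' a b).3) nF (add_comm _ _) hcG
    · exact hG.mirror.rises_of_limit w4 (fun E' a b => (hgood E' a b).4) nF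
        (by rw [mirror_apply, neg_neg, add_comm]; rfl)
        (by rwa [deriv_mirror, neg_neg, neg_eq_zero])
  exact ⟨hbox, horb.isGood hbox hq0⟩

/-! ### Good energies lie in the period annulus; the period function -/

theorem Rises.smul {f : ℝ → ℝ} {x c : ℝ} (h : Rises f x) (h0 : 0 ≤ c) (h1 : c ≤ 1) :
    Rises f (c * x) := by
  rcases le_or_gt x 0 with hx | hx
  · exact rises_of_nonpos (mul_nonpos_of_nonneg_of_nonpos h0 hx)
  · exact h.mono (by nlinarith)

theorem IsWell.apply_mul_le {f : ℝ → ℝ} (hf : IsWell f) {x c : ℝ} (h : Rises f x)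
    (h' : Rises (SeparableHamiltonian.mirror f) (-x)) (h0 : 0 ≤ c) (h1 : c ≤ 1) :
    f (c * x) ≤ f x := by
  rcases le_or_gt x 0 with hx | hx
  · have := (hf.mirror.strictMonoOn h').monotoneOn (a := c * -x) (b := -x)
      ⟨by nlinarith, by nlinarith⟩ ⟨by linarith, le_rfl⟩ (by nlinarith)
    simpa [mirror_apply] using this
  · exact (hf.strictMonoOn h).monotoneOn ⟨by positivity, by nlinarith⟩ ⟨hx.le, le_rfl⟩
      (by nlinarith)

theorem IsGood.exists_charts {F G : ℝ → ℝ} (hF : IsWell F) (hG : IsWell G) {E : ℝ} (hE : 0 < E)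
    (h : IsGood F G E) : ∃ f g, IsChart F √(2 * E) f ∧ IsChart G √(2 * E) g := by
  have h1 : √(2 * E) ^ 2 / 2 = E := by rw [Real.sq_sqrt (by positivity)]; ring
  have h2 : 0 < √(2 * E) := by positivity
  obtain ⟨f, hf⟩ := hF.exists_chart h2 (h1.symm ▸ h.1) (h1.symm ▸ h.2)
  obtain ⟨g, hg⟩ := hG.exists_chart h2 (h1.symm ▸ h.3) (h1.symm ▸ h.4)
  exact ⟨f, g, hf, hg⟩

/-- The region is star-shaped about the origin, because F and G decrease toward 0 along climbing
segments, and its nonzero points lie on the circles of the charts. -/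
theorem IsGood.isFilledNhd {F G : ℝ → ℝ} (hF : IsWell F) (hG : IsWell G) {E : ℝ} (hE : 0 < E)
    (h : IsGood F G E) : IsFilledNhd F G {p | InBox F G p ∧ energy F G p < E} := by
  have h0 : (0 : ℝ × ℝ) ∈ {p | InBox F G p ∧ energy F G p < E} := by
    refine ⟨⟨?_, ?_, ?_, ?_⟩, by simpa [energy, hF.zero, hG.zero] using hE⟩ <;>
      exact rises_of_nonpos (by simp)
  refine ⟨(isOpen_inBox hF hG).inter (isOpen_lt (continuous_energy hF hG) continuous_const),
    ?_, h0, ?_⟩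
  · refine (StarConvex.isPathConnected (starConvex_zero_iff.2 ?_) h0).isConnected
    rintro p ⟨hp, hpE⟩ c hc0 hc1
    refine ⟨⟨hp.fst.smul hc0 hc1, ?_, hp.snd.smul hc0 hc1, ?_⟩, lt_of_le_of_lt ?_ hpE⟩
    · have := hp.fst_mirror.smul hc0 hc1
      simpa using this
    · have := hp.snd_mirror.smul hc0 hc1
      simpa using this
    · exact add_le_add (hF.apply_mul_le hp.fst hp.fst_mirror hc0 hc1)
        (hG.apply_mul_le hp.snd hp.snd_mirror hc0 hc1)
  · rintro p ⟨hp, hpE⟩ hp0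
    obtain ⟨f, g, hf, hg⟩ := h.exists_charts hF hG hE
    have hpos : 0 < energy F G p := by
      refine (hp.energy_nonneg hF hG).lt_of_ne' fun h1 => hp0 ?_
      obtain ⟨nF, zF⟩ := hF.nonneg_of_limit (fun s a b => hp.1 s a b.le) fun s a b => hp.2 s a b.le
      obtain ⟨nG, zG⟩ := hG.nonneg_of_limit (fun s a b => hp.3 s a b.le) fun s a b => hp.4 s a b.le
      unfold energy at h1
      exact Prod.ext (zF (by linarith)) (zG (by linarith))
    set r := √(2 * energy F G p) with hr
    have hr0 : 0 < r := by positivity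
    have hrρ : r < √(2 * E) := Real.sqrt_lt_sqrt (by positivity) (by linarith)
    have hrE : r ^ 2 / 2 = energy F G p := by rw [hr, Real.sq_sqrt (by positivity)]; ring
    obtain ⟨φ, hφ⟩ := exists_isPhase hf hg hr0 hrρ
    obtain ⟨θ, hθ⟩ := exists_levelPoint_eq hF hG hf hg hr0 hrρ hp hrE.symm
    have hmin := isMinimalPeriod_levelPoint_comp hf hg hr0 hrρ hφ
    refine ⟨range fun t => levelPoint f g r (φ t), ⟨_, periodIntegral f g r,
      isSolution_levelPoint_comp hF hG hf hg hr0 hrρ hφ, hmin.1.1, hmin.1.2, ?_, rfl⟩, ?_, ?_⟩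
    -- A constant curve would also have half the minimal period as a period.
    · by_contra! hconst
      have h1 : periodIntegral f g r / 2 ∈
          {s : ℝ | 0 < s ∧ Function.Periodic (fun t => levelPoint f g r (φ t)) s} :=
        ⟨half_pos hmin.1.1, fun t => by simp only [hconst]⟩
      linarith [hmin.2 h1, hmin.1.1]
    · obtain ⟨t, rfl⟩ := hφ.surj θ
      exact ⟨t, hθ⟩
    · rintro _ ⟨t, rfl⟩
      exact ⟨inBox_levelPoint hf hg hr0 hrρ _, by
        rw [energy_levelPoint hf hg hr0 hrρ, hrE]
        exact hpE⟩

/-- Every solution of energy E in the annulus is, by uniqueness, the motion on one chart circle, so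
the set of minimal periods is a singleton. The charts depend on E₁ only, so the formula holds for
all E in (0, E₁) and can be differentiated. -/
theorem periodFunction_eq {F G f g : ℝ → ℝ} (hF : IsWell F) (hG : IsWell G) {E E₁ : ℝ}
    (hgood : IsGood F G E₁) (hf : IsChart F √(2 * E₁) f) (hg : IsChart G √(2 * E₁) g)
    (hE : 0 < E) (hEE : E < E₁) : periodFunction F G E = periodIntegral f g √(2 * E) := by
  have hr0 : 0 < √(2 * E) := by positivity
  have hrρ : √(2 * E) < √(2 * E₁) := Real.sqrt_lt_sqrt (by positivity) (by linarith)
  have hrE : √(2 * E) ^ 2 / 2 = E := by rw [Real.sq_sqrt (by positivity)]; ring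
  have hset : {τ : ℝ | ∃ γ : ℝ → ℝ × ℝ, IsSolution F G γ ∧ (∀ t, γ t ∈ periodAnnulus F G) ∧
      energy F G (γ 0) = E ∧ IsMinimalPeriod γ τ} = {periodIntegral f g √(2 * E)} := by
    refine Subset.antisymm ?_ (singleton_subset_iff.2 ?_)
    · rintro τ ⟨γ, hγ, hmem, hγE, hmin⟩
      obtain ⟨U, hU, hγU⟩ := hmem 0
      obtain ⟨φ, hφ, rfl⟩ := exists_isPhase_eq hF hG hf hg hr0 hrρ hγ
        (IsFilledNhd.subset_good hF hG hU hγU).1 (hγE.trans hrE.symm)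
      exact IsLeast.unique hmin (isMinimalPeriod_levelPoint_comp hf hg hr0 hrρ hφ)
    · obtain ⟨φ, hφ⟩ := exists_isPhase hf hg hr0 hrρ
      refine ⟨_, isSolution_levelPoint_comp hF hG hf hg hr0 hrρ hφ, fun t => ?_, ?_,
        isMinimalPeriod_levelPoint_comp hf hg hr0 hrρ hφ⟩
      · refine ⟨_, hgood.isFilledNhd hF hG (hE.trans hEE), inBox_levelPoint hf hg hr0 hrρ _, ?_⟩
        rw [energy_levelPoint hf hg hr0 hrρ, hrE]
        exact hEE
      · rw [energy_levelPoint hf hg hr0 hrρ, hrE]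
  rw [periodFunction, hset, csInf_singleton]

theorem exists_isGood_gt {F G : ℝ → ℝ} (hF : IsWell F) (hG : IsWell G) {E : ℝ}
    (hE : (E : EReal) < maxEnergy F G) : ∃ E₁, E < E₁ ∧ IsGood F G E₁ := by
  obtain ⟨p, hp⟩ := lt_iSup_iff.1 hE
  obtain ⟨⟨U, hU, hpU⟩, hlt⟩ := lt_iSup_iff.1 hp
  exact ⟨_, EReal.coe_lt_coe_iff.1 hlt, (IsFilledNhd.subset_good hF hG hU hpU).2⟩

/-- The sign σ = ±1 treats both monotonicity claims together; the chain rule through r = √(2E)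
contributes only positive factors. -/
theorem exists_hasDerivAt_periodFunction {F G : ℝ → ℝ} (hF : IsWell F) (hG : IsWell G)
    {E₀ : EReal} (hE₀ : E₀ ≤ maxEnergy F G) {σ : ℝ}
    (hM : ∀ x y : ℝ, (x, y) ∈ Omega F G E₀ → 0 ≤ σ * M F G x y) {E : ℝ} (hE : 0 < E)
    (hEE : (E : EReal) < E₀) : ∃ d, HasDerivAt (periodFunction F G) d E ∧ 0 ≤ σ * d := by
  obtain ⟨E₁, hEE₁, hgood⟩ := exists_isGood_gt hF hG (hEE.trans_le hE₀)
  obtain ⟨f, g, hf, hg⟩ := hgood.exists_charts hF hG (hE.trans hEE₁)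
  have hr0 : 0 < √(2 * E) := by positivity
  have hrρ : √(2 * E) < √(2 * E₁) := Real.sqrt_lt_sqrt (by positivity) (by linarith)
  have hrE : √(2 * E) ^ 2 / 2 = E := by rw [Real.sq_sqrt (by positivity)]; ring
  have h1 : HasDerivAt (fun E => √(2 * E)) (2 / (2 * √(2 * E))) E := by
    have := ((hasDerivAt_id E).const_mul 2).sqrt (by simpa using hE.ne')
    simpa using this
  have h2 := (hasDerivAt_periodIntegral hf.smooth hg.smooth hr0.ne').comp E h1
  refine ⟨_, h2.congr_of_eventuallyEq ?_, ?_⟩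
  · filter_upwards [Ioo_mem_nhds hE hEE₁] with E' hE'
    exact periodFunction_eq hF hG hgood hf hg hE'.1 hE'.2
  · have h3 : 0 ≤ σ * ∫ θ in (0 : ℝ)..2 * Real.pi,
        periodDerivDensity f g (√(2 * E) * Real.sin θ) (√(2 * E) * Real.cos θ) := by
      rw [← intervalIntegral.integral_const_mul]
      refine intervalIntegral.integral_nonneg Real.two_pi_pos.le fun θ _ =>
        periodDerivDensity_sign hF hG hf hg hr0 hrρ (fun x y hxy => hM x y ?_) θ
      rw [hrE] at hxy
      have hxy : energy F G (x, y) = E := hxy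
      exact ⟨hxy ▸ hE.le, hxy ▸ hEE.le⟩
    refine (mul_nonneg (by positivity : 0 ≤ (√(2 * E))⁻¹ * (2 / (2 * √(2 * E)))) h3).trans_eq ?_
    ring

end SeparableHamiltonian
end

theorem theorem1 (F G : ℝ → ℝ) (hF : ContDiff ℝ ∞ F) (hG : ContDiff ℝ ∞ G)
    (hGeven : ∀ y : ℝ, G (-y) = G y)
    (hF0 : F 0 = 0) (hG0 : G 0 = 0) (hF0' : deriv F 0 = 0) (hG0' : deriv G 0 = 0)
    (hF0'' : 0 < iteratedDeriv 2 F 0) (hG0'' : 0 < iteratedDeriv 2 G 0)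
    (E₀ : EReal) (hE₀ : 0 < E₀) (hE₀le : E₀ ≤ SeparableHamiltonian.maxEnergy F G) :
    ((∀ x y : ℝ, (x, y) ∈ SeparableHamiltonian.Omega F G E₀ →
        0 ≤ SeparableHamiltonian.M F G x y) →
      SeparableHamiltonian.MonotonicallyIncreasing
        (SeparableHamiltonian.periodFunction F G) E₀) ∧
    ((∀ x y : ℝ, (x, y) ∈ SeparableHamiltonian.Omega F G E₀ →
        SeparableHamiltonian.M F G x y ≤ 0) →
      SeparableHamiltonian.MonotonicallyDecreasing
        (SeparableHamiltonian.periodFunction F G) E₀) := by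
  have wF : SeparableHamiltonian.IsWell F := ⟨hF, hF0, hF0', hF0''⟩
  have wG : SeparableHamiltonian.IsWell G := ⟨hG, hG0, hG0', hG0''⟩
  refine ⟨fun hM E hE hEE => ?_, fun hM E hE hEE => ?_⟩
  · obtain ⟨d, hd, hsign⟩ := SeparableHamiltonian.exists_hasDerivAt_periodFunction wF wG hE₀le
      (σ := 1) (fun x y hxy => by simpa using hM x y hxy) hE hEE
    exact ⟨hd.differentiableAt, by rw [hd.deriv]; linarith⟩
  · obtain ⟨d, hd, hsign⟩ := SeparableHamiltonian.exists_hasDerivAt_periodFunction wF wG hE₀le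
      (σ := -1) (fun x y hxy => by simpa using hM x y hxy) hE hEE
    exact ⟨hd.differentiableAt, by rw [hd.deriv]; linarith⟩
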